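/- Let $F:\mathbb{R}^n\to\mathbb{R}^n$ be $C^1$ with $F(0)=0$, and let $E(e,t)$ denote the solution at time $t$ of $\dot e=F(e)$ with $E(e,0)=e$; assume that $E(e,t)$ is defined for all $e\in\mathbb{R}^n$ and all $t\ge 0$. Let $\Phi(e,t)\in\mathbb{R}^{n\times n}$ be the transition matrix of the variational equation, i.e. $\frac{\partial}{\partial t}\Phi(e,t)=\frac{\partial F}{\partial e}(E(e,t))\,\Phi(e,t)$, $\Phi(e,0)=I$. Let $|\cdot|$ be the Euclidean norm on vectors and the induced operator norm on matrices, and let inequalities between symmetric matrices be those of the Loewner order. Assume that there are functions $k,\tilde k$ of $|e|$ and real numbers $\lambda,\tilde\lambda>0$ such that, for all $e\in\mathbb{R}^n$ and $t\ge 0$, $$|E(e,t)|\le k(|e|)\,e^{-\lambda t}\,|e|,\qquad |\Phi(e,t)|\le \tilde k(|e|)\,e^{-\tilde\lambda t}.$$ Let $Q\in\mathbb{R}^{n\times n}$ be symmetric positive definite. Then: 1. For every $e$, $\Phi(e,t)$ exists for all $t\ge0$, and $P(e)=\int_0^{\infty}\Phi(e,s)^\top Q\,\Phi(e,s)\,ds=\lim_{T\to+\infty}\int_0^T\Phi(e,s)^\top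 Q\,\Phi(e,s)\,ds$ is well defined (the integral converges absolutely); the map $P:\mathbb{R}^n\to\mathbb{R}^{n\times n}$ is continuous. 2. There exist a nonincreasing function $\underline p$ and a nondecreasing function $\bar p$ on $[0,\infty)$ such that, for all $e\in\mathbb{R}^n$, $\underline p(|e|)>0$ and $\underline p(|e|)\,I\le P(e)\le \bar p(|e|)\,I$. 3. For all $e\in\mathbb{R}^n$ the two-sided limit $\mathfrak{d}_F P(e)=\lim_{h\to0}\frac{P(E(e,h))-P(e)}{h}$ exists, and $$\mathfrak{d}_F P(e)+P(e)\frac{\partial F}{\partial e}(e)+\frac{\partial F}{\partial e}(e)^\top P(e)\le -Q .$$ 4. If moreover $F$ is $C^3$, then $P$ is $C^2$. -/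

import Mathlib

open scoped Matrix MatrixOrder Matrix.Norms.L2Operator

noncomputable section

namespace ExpStab

/-- The set of times `t` (positive or negative) up to which the initial value problem
`γ' (s) = v s (γ s)`, `γ 0 = x₀` has a solution on the closed interval between `0` and `t`. -/
def solDomain {X : Type*} [NormedAddCommGroup X] [NormedSpace ℝ X]
    (v : ℝ → X → X) (x₀ : X) : Set ℝ :=
  {t | ∃ γ : ℝ → X, γ 0 = x₀ ∧ IsIntegralCurveOn γ v (Set.uIcc 0 t)}

open Classical in
/-- The value at time `t` of the solution of `γ' (s) = v s (γ s)`, `γ 0 = x₀`; it is meaningful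
for `t ∈ solDomain v x₀` when solutions are unique, and set to `0` for `t ∉ solDomain v x₀`. -/
def sol {X : Type*} [NormedAddCommGroup X] [NormedSpace ℝ X]
    (v : ℝ → X → X) (x₀ : X) (t : ℝ) : X :=
  if h : t ∈ solDomain v x₀ then Classical.choose h t else 0

variable {n : ℕ}

/-- The interval of existence of the maximal solution of `ė = F(e)` issued from `e`. -/
def flowDomain (F : EuclideanSpace ℝ (Fin n) → EuclideanSpace ℝ (Fin n))
    (e : EuclideanSpace ℝ (Fin n)) : Set ℝ :=
  solDomain (fun _ x => F x) e

/-- `E(e,t)`: the solution of `ė = F(e)` issued from `e`, evaluated at time `t`. -/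
def flow (F : EuclideanSpace ℝ (Fin n) → EuclideanSpace ℝ (Fin n))
    (e : EuclideanSpace ℝ (Fin n)) (t : ℝ) : EuclideanSpace ℝ (Fin n) :=
  sol (fun _ x => F x) e t

/-- The Jacobian matrix `∂F/∂e (e)`. -/
def jacobian (F : EuclideanSpace ℝ (Fin n) → EuclideanSpace ℝ (Fin n))
    (e : EuclideanSpace ℝ (Fin n)) : Matrix (Fin n) (Fin n) ℝ :=
  (Matrix.toEuclideanCLM (n := Fin n) (𝕜 := ℝ)).symm (fderiv ℝ F e)

/-- The right-hand side of the variational equation `Φ̇ = (∂F/∂e)(E(e,t)) Φ` along the solution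
issued from `e`. -/
def variationalField (F : EuclideanSpace ℝ (Fin n) → EuclideanSpace ℝ (Fin n))
    (e : EuclideanSpace ℝ (Fin n)) (t : ℝ) (M : Matrix (Fin n) (Fin n) ℝ) :
    Matrix (Fin n) (Fin n) ℝ :=
  jacobian F (flow F e t) * M

/-- `Φ(e,t)`: the transition matrix, `Φ̇(e,t) = (∂F/∂e)(E(e,t)) Φ(e,t)`, `Φ(e,0) = I`. -/
def transition (F : EuclideanSpace ℝ (Fin n) → EuclideanSpace ℝ (Fin n))
    (e : EuclideanSpace ℝ (Fin n)) (t : ℝ) : Matrix (Fin n) (Fin n) ℝ :=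
  sol (variationalField F e) 1 t

/-- The integrand `Φ(e,s)ᵀ Q Φ(e,s)`. -/
def lyapIntegrand (F : EuclideanSpace ℝ (Fin n) → EuclideanSpace ℝ (Fin n))
    (Q : Matrix (Fin n) (Fin n) ℝ) (e : EuclideanSpace ℝ (Fin n)) (s : ℝ) :
    Matrix (Fin n) (Fin n) ℝ :=
  (transition F e s)ᵀ * Q * transition F e s

/-- `P(e) = ∫₀^∞ Φ(e,s)ᵀ Q Φ(e,s) ds`. -/
def lyapMatrix (F : EuclideanSpace ℝ (Fin n) → EuclideanSpace ℝ (Fin n))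
    (Q : Matrix (Fin n) (Fin n) ℝ) (e : EuclideanSpace ℝ (Fin n)) :
    Matrix (Fin n) (Fin n) ℝ :=
  ∫ s in Set.Ioi (0 : ℝ), lyapIntegrand F Q e s

/-- The derivative of `P` along the solutions of `ė = F(e)`:
`𝔡_F P(e) = lim_{h → 0} (P(E(e,h)) - P(e)) / h` (two-sided limit). -/
def lieDeriv (F : EuclideanSpace ℝ (Fin n) → EuclideanSpace ℝ (Fin n))
    (P : EuclideanSpace ℝ (Fin n) → Matrix (Fin n) (Fin n) ℝ)
    (e : EuclideanSpace ℝ (Fin n)) : Matrix (Fin n) (Fin n) ℝ :=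
  deriv (fun h : ℝ => P (flow F e h)) 0

end ExpStab

end

/-! Everything rests on the identity P(e) = P_T(e) + Φ(e,T)ᵀ P(E(e,T)) Φ(e,T), where P_T is the
integral over [0,T] (`Stable.lyapMatrix_eq`). It comes from the cocycle property of Φ, and the
integral converges because the integrand is bounded by a decaying exponential. The function k̃ is
arbitrary, however, so this bound need not be locally uniform in e. Continuity and smoothness of P
therefore do not follow by dominated differentiation under the integral; they are read off the
identity.

Fix T with |Φ(0,T)| < 1/2. On a small ball around 0, E(·,T) does not increase the norm and X ↦ ΦᵀXΦ
has norm at most 1/4, so P is a bounded solution of an equation u = a + A·u∘ψ with A contracting.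
Such a solution is as smooth near 0 as its data (`contDiffOn_of_affine_eq`): the iterates started
from zero converge uniformly, so do their derivatives, and the limit derivative solves an equation
of the same kind. Every trajectory enters the ball, so applying the identity once more, with T
depending on the point, carries the smoothness to all of ℝⁿ (`Stable.contDiff_lyapMatrix`). The
count is one derivative lost: P is Cᵐ when F is Cᵐ⁺¹.

Smoothness of E, Φ and P_T in e comes from viewing trajectories as points of the Banach space
C([0,T], X). There the integral equation is a Cᵐ equation whose linearization, identity minus a
Volterra operator, is invertible, and the inverse function theorem applies.

Positivity of P follows from invertibility of Φ, and the two bounds from compactness. The matrix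
inequality is in fact an equality, obtained by differentiating P(E(y,t)) = Φ(y,t)⁻ᵀ (P(y) − P_t(y))
Φ(y,t)⁻¹. -/

namespace ExpStab

/-! ### Superposition operators x ↦ f ∘ x on spaces of continuous functions. -/

section Nemytskii

universe u

variable {K : Type*} [TopologicalSpace K] [CompactSpace K]

/-- Pointwise application of a continuous family of continuous linear maps, as a continuous
bilinear map. -/
noncomputable def pointwiseApply (K : Type*) [TopologicalSpace K] [CompactSpace K]
    (X Y : Type*) [NormedAddCommGroup X] [NormedSpace ℝ X] [NormedAddCommGroup Y]
    [NormedSpace ℝ Y] : C(K, X →L[ℝ] Y) →L[ℝ] C(K, X) →L[ℝ] C(K, Y) :=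
  LinearMap.mkContinuous₂
    (LinearMap.mk₂ ℝ
      (fun (B : C(K, X →L[ℝ] Y)) (x : C(K, X)) =>
        (⟨fun t => B t (x t), B.continuous.clm_apply x.continuous⟩ : C(K, Y)))
      (fun _ _ _ => by ext; simp) (fun _ _ _ => by ext; simp)
      (fun _ _ _ => by ext; simp) (fun _ _ _ => by ext; simp)) 1
    (fun B x => by
      rw [ContinuousMap.norm_le _ (by positivity)]
      intro t
      simp only [LinearMap.mk₂_apply, ContinuousMap.coe_mk, one_mul]
      exact (B t).le_of_opNorm_le_of_le (B.norm_coe_le_norm t) (x.norm_coe_le_norm t))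

@[simp]
lemma pointwiseApply_apply {X Y : Type*} [NormedAddCommGroup X] [NormedSpace ℝ X]
    [NormedAddCommGroup Y] [NormedSpace ℝ Y] (B : C(K, X →L[ℝ] Y)) (x : C(K, X)) (t : K) :
    pointwiseApply K X Y B x t = B t (x t) := rfl

variable {X Y : Type u} [NormedAddCommGroup X] [NormedSpace ℝ X] [NormedAddCommGroup Y]
  [NormedSpace ℝ Y]

/-- Mean value inequality on the segment from `x t` to `y t`, for each `t`. Uniformity in `t` comes
from continuity of `y ↦ f' ∘ y` in the sup norm, so `X` need not be locally compact. -/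
lemma hasFDerivAt_comp_continuousMap (f : C(X, Y)) (f' : C(X, X →L[ℝ] Y))
    (hf : ∀ x, HasFDerivAt f (f' x) x) (x : C(K, X)) :
    HasFDerivAt (fun x : C(K, X) => f.comp x) (pointwiseApply K X Y (f'.comp x)) x := by
  rw [hasFDerivAt_iff_isLittleO, Asymptotics.isLittleO_iff]
  intro c hc
  have hcont : Continuous fun y : C(K, X) => f'.comp y := ContinuousMap.continuous_postcomp f'
  obtain ⟨δ, hδ, hball⟩ := (Metric.continuous_iff (α := C(K, X))
    (β := C(K, X →L[ℝ] Y))).1 hcont x c hc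
  filter_upwards [Metric.ball_mem_nhds x hδ] with y hy
  rw [ContinuousMap.norm_le _ (by positivity)]
  intro t
  have key := (convex_segment (x t) (y t)).norm_image_sub_le_of_norm_hasFDerivWithin_le'
    (f := f) (f' := f') (φ := f' (x t)) (C := c)
    (fun z _ => (hf z).hasFDerivWithinAt) (fun z hz => ?_) (left_mem_segment ℝ _ _)
    (right_mem_segment ℝ _ _)
  · refine key.trans ?_
    gcongr
    exact (y - x).norm_coe_le_norm t
  · obtain ⟨θ, ⟨h0, h1⟩, rfl⟩ := (segment_eq_image' ℝ (x t) (y t)) ▸ hz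
    have hz : dist (x + θ • (y - x)) x < δ := by
      -- A point of the segment at one `t` is the value at `t` of the path `x + θ • (y - x)`, which
      -- lies in the δ-ball as a whole.
      rw [dist_eq_norm, add_sub_cancel_left, norm_smul, Real.norm_of_nonneg h0]
      rw [mem_ball_iff_norm] at hy
      nlinarith [norm_nonneg (y - x)]
    have := (ContinuousMap.dist_apply_le_dist t).trans (hball _ hz).le
    simpa [dist_eq_norm] using this

/-- Induction on `m`: the derivative is `pointwiseApply` of the superposition operator of `f'`. The
codomain changes to `X →L[ℝ] Y`, hence the quantification over `Y` inside the induction. -/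
lemma contDiff_comp_continuousMap (m : ℕ) :
    ∀ {Y : Type u} [NormedAddCommGroup Y] [NormedSpace ℝ Y] (f : C(X, Y)), ContDiff ℝ m f →
      ContDiff ℝ m (fun x : C(K, X) => f.comp x) := by
  induction m with
  | zero =>
    intro Y _ _ f _
    exact contDiff_zero.2 (ContinuousMap.continuous_postcomp f)
  | succ m ih =>
    intro Y _ _ f hf
    push_cast at hf ⊢
    obtain ⟨f', hf', hd⟩ := contDiff_succ_iff_hasFDerivAt.1 hf
    have h := (pointwiseApply K X Y).contDiff.comp
      (ih (⟨f', hf'.continuous⟩ : C(X, X →L[ℝ] Y)) hf')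
    exact contDiff_succ_iff_hasFDerivAt.2
      ⟨_, h, fun x => hasFDerivAt_comp_continuousMap f ⟨f', hf'.continuous⟩ hd x⟩

lemma contDiff_pointwiseApply {Z : Type*} [NormedAddCommGroup Z] [NormedSpace ℝ Z]
    {m : WithTop ℕ∞} {B : Z → C(K, X →L[ℝ] Y)} (hB : ContDiff ℝ m B) :
    ContDiff ℝ m (fun z => pointwiseApply K X Y (B z)) := by
  have h := (pointwiseApply K X Y).contDiff.comp hB
  exact h

end Nemytskii

/-! ### Volterra operators on [0, T] and invertibility of the identity minus a linear one. -/

section Volterra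

variable {X : Type*} [NormedAddCommGroup X] [NormedSpace ℝ X] {T : ℝ}

/-- Integration from `0`, as an operator on continuous functions on `[0, T]`. -/
noncomputable def volterra (X : Type*) [NormedAddCommGroup X] [NormedSpace ℝ X] (hT : 0 ≤ T) :
    C(Set.Icc (0 : ℝ) T, X) →L[ℝ] C(Set.Icc (0 : ℝ) T, X) :=
  LinearMap.mkContinuous
    { toFun := fun x => ⟨fun t => ∫ s in (0 : ℝ)..t, x (Set.projIcc 0 T hT s),
        (intervalIntegral.continuous_primitive (fun a b =>
          (x.continuous.comp continuous_projIcc).intervalIntegrable a b) 0).comp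
            continuous_subtype_val⟩
      map_add' := fun x y => by
        ext t
        exact intervalIntegral.integral_add
          ((x.continuous.comp continuous_projIcc).intervalIntegrable _ _)
          ((y.continuous.comp continuous_projIcc).intervalIntegrable _ _)
      map_smul' := fun c x => by
        ext t
        exact intervalIntegral.integral_smul c _ } T
    (fun x => by
      rw [ContinuousMap.norm_le _ (by positivity)]
      intro t
      refine (intervalIntegral.norm_integral_le_of_norm_le_const
        (fun s _ => x.norm_coe_le_norm (Set.projIcc 0 T hT s))).trans ?_
      rw [sub_zero, abs_of_nonneg t.2.1, mul_comm]
      exact mul_le_mul_of_nonneg_right t.2.2 (norm_nonneg x))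

lemma volterra_apply (hT : 0 ≤ T) (x : C(Set.Icc (0 : ℝ) T, X)) (t : Set.Icc (0 : ℝ) T) :
    volterra X hT x t = ∫ s in (0 : ℝ)..t, x (Set.projIcc 0 T hT s) := rfl

/-- The operator `x ↦ ∫₀ᵗ B(s) x(s) ds`. -/
noncomputable def linVolterra (hT : 0 ≤ T) (B : C(Set.Icc (0 : ℝ) T, X →L[ℝ] X)) :
    C(Set.Icc (0 : ℝ) T, X) →L[ℝ] C(Set.Icc (0 : ℝ) T, X) :=
  volterra X hT ∘L pointwiseApply _ X X B

/-- Each iteration integrates the previous bound once more, which turns tʲ/j! into tʲ⁺¹/(j+1)!. -/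
lemma norm_linVolterra_pow_apply_le (hT : 0 ≤ T) (B : C(Set.Icc (0 : ℝ) T, X →L[ℝ] X))
    (x : C(Set.Icc (0 : ℝ) T, X)) (j : ℕ) (t : Set.Icc (0 : ℝ) T) :
    ‖(linVolterra hT B ^ j) x t‖ ≤ (‖B‖ * t) ^ j / j.factorial * ‖x‖ := by
  induction j generalizing t with
  | zero => simpa using x.norm_coe_le_norm t
  | succ j ih =>
    rw [pow_succ', mul_apply_eq_comp]
    change ‖∫ s in (0 : ℝ)..t, B (Set.projIcc 0 T hT s)
      ((linVolterra hT B ^ j) x (Set.projIcc 0 T hT s))‖ ≤ _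
    have hb : ∀ s ∈ Set.Ioc (0 : ℝ) t, ‖B (Set.projIcc 0 T hT s)
        ((linVolterra hT B ^ j) x (Set.projIcc 0 T hT s))‖ ≤
        ‖B‖ ^ (j + 1) / j.factorial * ‖x‖ * s ^ j := by
      intro s hs
      have hs' : s ∈ Set.Icc 0 T := ⟨hs.1.le, hs.2.trans t.2.2⟩
      have h1 := ih (Set.projIcc 0 T hT s)
      rw [Set.projIcc_of_mem hT hs'] at h1 ⊢
      refine ((B ⟨s, hs'⟩).le_of_opNorm_le_of_le (B.norm_coe_le_norm _) h1).trans_eq ?_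
      simp only [mul_pow]
      ring
    refine (intervalIntegral.norm_integral_le_of_norm_le t.2.1
      (Filter.Eventually.of_forall hb) (by
        exact (Continuous.intervalIntegrable (by fun_prop) _ _))).trans_eq ?_
    rw [intervalIntegral.integral_const_mul, integral_pow, Nat.factorial_succ]
    push_cast
    have : (j.factorial : ℝ) ≠ 0 := by positivity
    field_simp
    ring

/-- The factorial wins over any `T`: some power Vʲ has norm below 1, so 1 − Vʲ is a unit. It is the
product of the commuting factors 1 − V and Σ Vⁱ, so both are units. -/
lemma isUnit_one_sub_linVolterra [CompleteSpace X] (hT : 0 ≤ T)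
    (B : C(Set.Icc (0 : ℝ) T, X →L[ℝ] X)) : IsUnit (1 - linVolterra hT B) := by
  have hlim := FloorSemiring.tendsto_pow_div_factorial_atTop (‖B‖ * T)
  obtain ⟨j, hj⟩ := (hlim.eventually_lt_const one_pos).exists
  have hnorm : ‖linVolterra hT B ^ j‖ < 1 := by
    refine lt_of_le_of_lt (ContinuousLinearMap.opNorm_le_bound _ (by positivity) fun x => ?_) hj
    rw [ContinuousMap.norm_le _ (by positivity)]
    intro t
    refine (norm_linVolterra_pow_apply_le hT B x j t).trans ?_
    gcongr
    · exact mul_nonneg (norm_nonneg B) t.2.1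
    · exact t.2.2
  have hu : IsUnit (1 - linVolterra hT B ^ j) := 
    isUnit_one_sub_of_norm_lt_one
      (R := C(Set.Icc (0 : ℝ) T, X) →L[ℝ] C(Set.Icc (0 : ℝ) T, X)) hnorm
  rw [← mul_neg_geom_sum] at hu
  have hc : Commute (1 - linVolterra hT B) (∑ i ∈ Finset.range j, linVolterra hT B ^ i) := by
    refine Commute.sum_right _ _ _ fun i _ => ?_
    exact ((Commute.one_left _).sub_left (Commute.refl _)).pow_right i
  exact (hc.isUnit_mul_iff.1 hu).1

end Volterra

/-! ### Linear differential equations and their dependence on the coefficient. -/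

section LinearEquation

variable {X : Type*} [NormedAddCommGroup X] [NormedSpace ℝ X] {T : ℝ}

/-- The solution on `[0, T]` of the linear equation `x' = B(t) x`, `x(0) = y`. -/
noncomputable def linSol (hT : 0 ≤ T) (B : C(Set.Icc (0 : ℝ) T, X →L[ℝ] X)) (y : X) :
    C(Set.Icc (0 : ℝ) T, X) :=
  Ring.inverse (1 - linVolterra hT B) (ContinuousMap.const _ y)

lemma one_sub_linVolterra_apply_eq_iff (hT : 0 ≤ T) (B : C(Set.Icc (0 : ℝ) T, X →L[ℝ] X))
    (x z : C(Set.Icc (0 : ℝ) T, X)) :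
    (1 - linVolterra hT B) x = z ↔ x = z + linVolterra hT B x := by
  rw [← sub_eq_iff_eq_add]; rfl

lemma linSol_eq [CompleteSpace X] (hT : 0 ≤ T) (B : C(Set.Icc (0 : ℝ) T, X →L[ℝ] X)) (y : X) :
    linSol hT B y = ContinuousMap.const _ y + linVolterra hT B (linSol hT B y) := by
  rw [← one_sub_linVolterra_apply_eq_iff, linSol, ← mul_apply_eq_comp,
    Ring.mul_inverse_cancel _ (isUnit_one_sub_linVolterra hT B)]
  rfl

lemma eq_linSol [CompleteSpace X] (hT : 0 ≤ T) (B : C(Set.Icc (0 : ℝ) T, X →L[ℝ] X)) (y : X)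
    (x : C(Set.Icc (0 : ℝ) T, X)) (hx : x = ContinuousMap.const _ y + linVolterra hT B x) :
    x = linSol hT B y := by
  rw [linSol, ← (one_sub_linVolterra_apply_eq_iff hT B x _).2 hx, ← mul_apply_eq_comp,
    Ring.inverse_mul_cancel _ (isUnit_one_sub_linVolterra hT B)]
  rfl

/-- The solution is an operator inverse applied to a constant, and inversion is smooth at units. -/
lemma contDiff_linSol [CompleteSpace X] {Z : Type*} [NormedAddCommGroup Z] [NormedSpace ℝ Z]
    {m : WithTop ℕ∞} (hT : 0 ≤ T) {B : Z → C(Set.Icc (0 : ℝ) T, X →L[ℝ] X)} (hB : ContDiff ℝ m B) (y : X) :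
    ContDiff ℝ m (fun z => linSol hT (B z) y) := by
  have h1 : ContDiff ℝ m (fun z => 1 - linVolterra hT (B z)) :=
    contDiff_const.sub (contDiff_const.clm_comp (contDiff_pointwiseApply hB))
  refine ContDiff.clm_apply ?_ contDiff_const
  rw [contDiff_iff_contDiffAt]
  intro z
  obtain ⟨u, hu⟩ := isUnit_one_sub_linVolterra hT (B z)
  have h2 := contDiffAt_ringInverse ℝ (n := m)
    (R := C(Set.Icc (0 : ℝ) T, X) →L[ℝ] C(Set.Icc (0 : ℝ) T, X)) u
  rw [hu] at h2
  exact h2.comp z h1.contDiffAt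

end LinearEquation

/-! ### Smooth dependence on the initial condition by the inverse function theorem. -/

section SmoothDependence

universe u

variable {X : Type u} [NormedAddCommGroup X] [NormedSpace ℝ X] {T : ℝ}

/-- Solutions of `x = e + ∫ F(x)` on `[0, T]` depend smoothly on `e`. -/
lemma contDiff_of_eq_const_add_volterra [CompleteSpace X] (hT : 0 ≤ T) {m : ℕ}
    (hm : m ≠ 0) (F : C(X, X))
    (hF : ContDiff ℝ m F) (S : X → C(Set.Icc (0 : ℝ) T, X))
    (hS : ∀ e, S e = ContinuousMap.const _ e + volterra X hT (F.comp (S e)))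
    (huniq : ∀ e x, x = ContinuousMap.const _ e + volterra X hT (F.comp x) → x = S e) :
    ContDiff ℝ m S := by
  have hm1 : (1 : WithTop ℕ∞) ≤ m := by exact_mod_cast Nat.one_le_iff_ne_zero.2 hm
  have hF1 := hF.of_le hm1
  let F' : C(X, X →L[ℝ] X) := ⟨fderiv ℝ F, hF1.continuous_fderiv one_ne_zero⟩
  let H : C(Set.Icc (0 : ℝ) T, X) → C(Set.Icc (0 : ℝ) T, X) :=
    fun x => x - volterra X hT (F.comp x)
  have hH : ContDiff ℝ m H :=
    contDiff_id.sub ((volterra X hT).contDiff.comp (contDiff_comp_continuousMap m F hF))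
  let c : X →L[ℝ] C(Set.Icc (0 : ℝ) T, X) := ContinuousLinearMap.const ℝ _
  rw [contDiff_iff_contDiffAt]
  intro e₀
  obtain ⟨U, hU⟩ := isUnit_one_sub_linVolterra hT (F'.comp (S e₀))
  have hd : HasFDerivAt H
      (ContinuousLinearEquiv.ofUnit U : C(Set.Icc (0 : ℝ) T, X) →L[ℝ] C(Set.Icc (0 : ℝ) T, X))
      (S e₀) := by
    have h1 : HasFDerivAt H (1 - linVolterra hT (F'.comp (S e₀))) (S e₀) :=
      (hasFDerivAt_id _).sub ((volterra X hT).hasFDerivAt.comp _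
        (hasFDerivAt_comp_continuousMap F F'
          (fun x => (hF1.differentiable one_ne_zero x).hasFDerivAt) (S e₀)))
    rw [← hU] at h1
    exact h1
  have hH0 : H (S e₀) = ContinuousMap.const _ e₀ := sub_eq_of_eq_add (hS e₀)
  have hne : (m : WithTop ℕ∞) ≠ 0 := by exact_mod_cast hm
  -- For `e` near `e₀`, the local inverse of `H` at the constant path `e` solves the integral
  -- equation, so `huniq` identifies it with `S e`. No prior continuity of `S` is needed.
  have hinv := hH.contDiffAt.to_localInverse hd hne
  have hright := (hH.contDiffAt.hasStrictFDerivAt' hd hne).eventually_right_inverse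
  rw [hH0] at hinv hright
  have hc : ContDiff ℝ m (fun e : X => ContinuousMap.const (Set.Icc (0 : ℝ) T) e) := c.contDiff
  refine (hinv.comp e₀ hc.contDiffAt).congr_of_eventuallyEq ?_
  filter_upwards [hc.continuous.continuousAt.eventually hright] with e he
  exact (huniq e _ (sub_eq_iff_eq_add.1 he)).symm

/-- This is the variational equation in integral form, got by differentiating the fixed-point
equation of `S`. -/
lemma fderiv_apply_eq_const_add_linVolterra (hT : 0 ≤ T) (F : C(X, X))
    (hF : ContDiff ℝ 1 F) (S : X → C(Set.Icc (0 : ℝ) T, X))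
    (hS : ∀ e, S e = ContinuousMap.const _ e + volterra X hT (F.comp (S e)))
    (hSd : Differentiable ℝ S) (e v : X) :
    fderiv ℝ S e v = ContinuousMap.const _ v + linVolterra hT
      ((⟨fderiv ℝ F, hF.continuous_fderiv one_ne_zero⟩ : C(X, X →L[ℝ] X)).comp (S e))
      (fderiv ℝ S e v) := by
  let F' : C(X, X →L[ℝ] X) := ⟨fderiv ℝ F, hF.continuous_fderiv one_ne_zero⟩
  let c : X →L[ℝ] C(Set.Icc (0 : ℝ) T, X) := ContinuousLinearMap.const ℝ _
  have h1 : HasFDerivAt S (c + linVolterra hT (F'.comp (S e)) ∘L fderiv ℝ S e) e := by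
    have h2 : HasFDerivAt (fun e => c e + volterra X hT (F.comp (S e)))
        (c + linVolterra hT (F'.comp (S e)) ∘L fderiv ℝ S e) e :=
      c.hasFDerivAt.add ((volterra X hT).hasFDerivAt.comp e
        ((hasFDerivAt_comp_continuousMap F F'
          (fun x => (hF.differentiable one_ne_zero x).hasFDerivAt) (S e)).comp e
            (hSd e).hasFDerivAt))
    exact h2.congr_of_eventuallyEq (Filter.Eventually.of_forall hS)
  conv_lhs => rw [h1.fderiv]
  rfl

end SmoothDependence

/-! ### Regularity of bounded solutions of u = a + A·u∘ψ near the origin. -/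

section Contraction

universe u

open Metric Filter Topology

variable {X : Type u} [NormedAddCommGroup X]

/-- Iterates, started at zero, of the affine operator `u ↦ a + A • u ∘ ψ`. -/
noncomputable def affineIter {Y : Type*} [NormedAddCommGroup Y] [NormedSpace ℝ Y]
    (a : X → Y) (A : X → Y →L[ℝ] Y) (ψ : X → X) : ℕ → X → Y
  | 0 => fun _ => 0
  | j + 1 => fun x => a x + A x (affineIter a A ψ j (ψ x))

lemma norm_sub_affineIter_le {Y : Type*} [NormedAddCommGroup Y] [NormedSpace ℝ Y]
    {a : X → Y} {A : X → Y →L[ℝ] Y} {ψ : X → X} {u : X → Y} {r M : ℝ}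
    (hψ : ∀ x ∈ ball (0 : X) r, ‖ψ x‖ ≤ ‖x‖) (hA : ∀ x ∈ ball (0 : X) r, ‖A x‖ ≤ 1 / 2)
    (hu : ∀ x ∈ ball (0 : X) r, u x = a x + A x (u (ψ x)))
    (hM : ∀ x ∈ ball (0 : X) r, ‖u x‖ ≤ M) (j : ℕ) :
    ∀ x ∈ ball (0 : X) r, ‖u x - affineIter a A ψ j x‖ ≤ M * (1 / 2) ^ j := by
  induction j with
  | zero => intro x hx; simpa [affineIter] using hM x hx
  | succ j ih =>
    intro x hx
    have hx' : ψ x ∈ ball (0 : X) r := by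
      have := hψ x hx
      rw [mem_ball_zero_iff] at hx ⊢
      exact this.trans_lt hx
    rw [hu x hx, affineIter, add_sub_add_left_eq_sub, ← map_sub]
    refine ((A x).le_of_opNorm_le_of_le (hA x hx) (ih _ hx')).trans_eq ?_
    ring

/-- A bounded solution is the uniform limit of the continuous iterates, whatever its own regularity.
-/
lemma continuousOn_of_affine_eq {Y : Type*} [NormedAddCommGroup Y] [NormedSpace ℝ Y]
    {a : X → Y} {A : X → Y →L[ℝ] Y} {ψ : X → X} {u : X → Y} {r M : ℝ}
    (ha : ContinuousOn a (ball 0 r)) (hAc : ContinuousOn A (ball 0 r))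
    (hψc : ContinuousOn ψ (ball 0 r))
    (hψ : ∀ x ∈ ball (0 : X) r, ‖ψ x‖ ≤ ‖x‖) (hA : ∀ x ∈ ball (0 : X) r, ‖A x‖ ≤ 1 / 2)
    (hu : ∀ x ∈ ball (0 : X) r, u x = a x + A x (u (ψ x)))
    (hM : ∀ x ∈ ball (0 : X) r, ‖u x‖ ≤ M) : ContinuousOn u (ball 0 r) := by
  have hmaps : Set.MapsTo ψ (ball (0 : X) r) (ball 0 r) := fun x hx => by
    have := hψ x hx
    rw [mem_ball_zero_iff] at hx ⊢
    exact this.trans_lt hx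
  have hiter : ∀ j, ContinuousOn (affineIter a A ψ j) (ball 0 r) := by
    intro j
    induction j with
    | zero => exact continuousOn_const
    | succ j ih => exact ha.add (hAc.clm_apply (ih.comp hψc hmaps))
  have hlim : Tendsto (fun j : ℕ => M * (1 / 2 : ℝ) ^ j) atTop (𝓝 0) := by
    simpa using (tendsto_pow_atTop_nhds_zero_of_lt_one (r := (1 / 2 : ℝ)) (by norm_num)
      (by norm_num)).const_mul M
  have hunif : TendstoUniformlyOn (affineIter a A ψ) u atTop (ball 0 r) := by
    rw [Metric.tendstoUniformlyOn_iff]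
    intro ε hε
    filter_upwards [hlim.eventually_lt_const hε] with j hj x hx
    rw [dist_eq_norm]
    exact (norm_sub_affineIter_le hψ hA hu hM j x hx).trans_lt hj
  exact hunif.continuousOn (Frequently.of_forall hiter)

variable [NormedSpace ℝ X]

/-- A bounded solution of `u = a + A • u ∘ ψ` with `C¹` data is differentiable. -/
lemma exists_hasFDerivAt_of_affine_eq {Y : Type*} [NormedAddCommGroup Y] [NormedSpace ℝ Y]
    [CompleteSpace Y]
    {a : X → Y} {A : X → Y →L[ℝ] Y} {ψ : X → X} {u : X → Y} {r M C : ℝ}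
    {a' : X → X →L[ℝ] Y} {A' : X → X →L[ℝ] Y →L[ℝ] Y} {ψ' : X → X →L[ℝ] X}
    (ha : ∀ x ∈ ball (0 : X) r, HasFDerivAt a (a' x) x)
    (hAd : ∀ x ∈ ball (0 : X) r, HasFDerivAt A (A' x) x)
    (hψd : ∀ x ∈ ball (0 : X) r, HasFDerivAt ψ (ψ' x) x)
    (ha' : ∀ x ∈ ball (0 : X) r, ‖a' x‖ ≤ C) (hA' : ∀ x ∈ ball (0 : X) r, ‖A' x‖ ≤ C)
    (hψ' : ∀ x ∈ ball (0 : X) r, ‖ψ' x‖ ≤ 1)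
    (hψ : ∀ x ∈ ball (0 : X) r, ‖ψ x‖ ≤ ‖x‖) (hA : ∀ x ∈ ball (0 : X) r, ‖A x‖ ≤ 1 / 2)
    (hu : ∀ x ∈ ball (0 : X) r, u x = a x + A x (u (ψ x)))
    (hM : ∀ x ∈ ball (0 : X) r, ‖u x‖ ≤ M) :
    ∃ (w : X → X →L[ℝ] Y) (D : ℝ), (∀ x ∈ ball (0 : X) r, HasFDerivAt u (w x) x) ∧
      ∀ x ∈ ball (0 : X) r, ‖w x‖ ≤ D := by
  rcases le_or_gt r 0 with hr | hr
  · exact ⟨0, 0, by simp [ball_eq_empty.2 hr]⟩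
  have hM0 : 0 ≤ M := (norm_nonneg _).trans (hM 0 (mem_ball_self hr))
  have hC0 : 0 ≤ C := (norm_nonneg _).trans (ha' 0 (mem_ball_self hr))
  have hmaps : ∀ x ∈ ball (0 : X) r, ψ x ∈ ball (0 : X) r := fun x hx => by
    have := hψ x hx
    rw [mem_ball_zero_iff] at hx ⊢
    exact this.trans_lt hx
  let g : ℕ → X → Y := affineIter a A ψ
  -- The derivatives of the iterates, defined by differentiating the recursion.
  let g' : ℕ → X → X →L[ℝ] Y := fun j => Nat.rec (fun _ => 0) (fun j w x =>
    a' x + (A x ∘L (w (ψ x) ∘L ψ' x) + (A' x).flip (g j (ψ x)))) j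
  have hg'0 : ∀ x, g' 0 x = 0 := fun _ => rfl
  have hg'succ : ∀ j x, g' (j + 1) x =
    a' x + (A x ∘L (g' j (ψ x) ∘L ψ' x) + (A' x).flip (g j (ψ x))) := fun _ _ => rfl
  have hgd : ∀ j, ∀ x ∈ ball (0 : X) r, HasFDerivAt (g j) (g' j x) x := by
    intro j
    induction j with
    | zero => intro x _; exact hasFDerivAt_const _ _
    | succ j ih =>
      intro x hx
      exact (ha x hx).add ((hAd x hx).clm_apply ((ih _ (hmaps x hx)).comp x (hψd x hx)))
  have hgdiff : ∀ j, ∀ x ∈ ball (0 : X) r, ‖g (j + 1) x - g j x‖ ≤ 2 * M * (1 / 2) ^ j := by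
    intro j x hx
    have h1 := norm_sub_affineIter_le hψ hA hu hM j x hx
    have h2 := norm_sub_affineIter_le hψ hA hu hM (j + 1) x hx
    have h3 : g (j + 1) x - g j x = (u x - g j x) - (u x - g (j + 1) x) := by abel
    rw [h3]
    refine (norm_sub_le _ _).trans ((add_le_add h1 h2).trans ?_)
    rw [pow_succ]
    nlinarith [mul_nonneg hM0 (pow_nonneg (by norm_num : (0 : ℝ) ≤ 1 / 2) j)]
  -- If dⱼ bounds the j-th increment of `g'`, then dⱼ₊₁ ≤ dⱼ/2 + 2CM(1/2)ʲ. Since 2CM ≤ D/4, the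
  -- bound D(3/4)ʲ propagates, as 1/2 + 1/4 = 3/4; the summand `C` covers j = 0.
  set D := 8 * C * M + C with hD
  have hg'diff : ∀ j, ∀ x ∈ ball (0 : X) r, ‖g' (j + 1) x - g' j x‖ ≤ D * (3 / 4) ^ j := by
    intro j
    induction j with
    | zero =>
      intro x hx
      rw [hg'succ, hg'0, hg'0]
      simp only [ContinuousLinearMap.zero_comp, ContinuousLinearMap.comp_zero, sub_zero,
        pow_zero, mul_one, g, affineIter, map_zero, add_zero]
      exact (ha' x hx).trans (by rw [hD]; nlinarith [mul_nonneg hC0 hM0])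
    | succ j ih =>
      intro x hx
      have e1 : g' (j + 1 + 1) x - g' (j + 1) x =
          A x ∘L ((g' (j + 1) (ψ x) - g' j (ψ x)) ∘L ψ' x) +
            (A' x).flip (g (j + 1) (ψ x) - g j (ψ x)) := by
        rw [hg'succ (j + 1), hg'succ j x, ContinuousLinearMap.sub_comp,
          ContinuousLinearMap.comp_sub, map_sub]
        abel
      have hx' := hmaps x hx
      have b1 : ‖A x ∘L ((g' (j + 1) (ψ x) - g' j (ψ x)) ∘L ψ' x)‖ ≤
          1 / 2 * (D * (3 / 4) ^ j * 1) :=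
        (ContinuousLinearMap.opNorm_comp_le _ _).trans (mul_le_mul (hA x hx)
          ((ContinuousLinearMap.opNorm_comp_le _ _).trans (mul_le_mul (ih _ hx') (hψ' x hx)
            (norm_nonneg _) ((norm_nonneg _).trans (ih _ hx')))) (norm_nonneg _) (by norm_num))
      have b2 : ‖(A' x).flip (g (j + 1) (ψ x) - g j (ψ x))‖ ≤ C * (2 * M * (1 / 2) ^ j) :=
        (A' x).flip.le_of_opNorm_le_of_le (by
          rw [ContinuousLinearMap.opNorm_flip]; exact hA' x hx) (hgdiff j _ hx')
      rw [e1]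
      refine (norm_add_le _ _).trans ((add_le_add b1 b2).trans ?_)
      have h12 : (1 / 2 : ℝ) ^ j ≤ (3 / 4) ^ j :=
        pow_le_pow_left₀ (by norm_num) (by norm_num) j
      have hp : (0 : ℝ) ≤ (3 / 4) ^ j := by positivity
      have h13 := mul_le_mul_of_nonneg_left h12 (mul_nonneg hC0 hM0)
      have h14 := mul_nonneg hC0 hp
      rw [pow_succ, hD]
      nlinarith
  have hdist : ∀ x ∈ ball (0 : X) r, ∀ j, dist (g' j x) (g' (j + 1) x) ≤ D * (3 / 4) ^ j := by
    intro x hx j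
    rw [dist_comm, dist_eq_norm]
    exact hg'diff j x hx
  have hlim : ∀ x ∈ ball (0 : X) r, ∃ l, Tendsto (fun j => g' j x) atTop (𝓝 l) := fun x hx =>
    cauchySeq_tendsto_of_complete (cauchySeq_of_le_geometric _ _ (by norm_num) (hdist x hx))
  choose! w hw using hlim
  have hwdist : ∀ x ∈ ball (0 : X) r, ∀ j, dist (g' j x) (w x) ≤ D * (3 / 4) ^ j / (1 - 3 / 4) :=
    fun x hx j => dist_le_of_le_geometric_of_tendsto _ _ (by norm_num) (hdist x hx) (hw x hx) j
  have h0 : Tendsto (fun j : ℕ => M * (1 / 2 : ℝ) ^ j) atTop (𝓝 0) := by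
    simpa using (tendsto_pow_atTop_nhds_zero_of_lt_one (r := (1 / 2 : ℝ)) (by norm_num)
      (by norm_num)).const_mul M
  have h0' : Tendsto (fun j : ℕ => D * (3 / 4 : ℝ) ^ j / (1 - 3 / 4)) atTop (𝓝 0) := by
    simpa using ((tendsto_pow_atTop_nhds_zero_of_lt_one (r := (3 / 4 : ℝ)) (by norm_num)
      (by norm_num)).const_mul D).div_const (1 - 3 / 4)
  refine ⟨w, D * (3 / 4) ^ 0 / (1 - 3 / 4), fun x hx =>
    hasFDerivAt_of_tendstoUniformlyOn isOpen_ball (f := g) (f' := g') (l := atTop) ?_ hgd ?_ hx,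
    fun x hx => ?_⟩
  · rw [Metric.tendstoUniformlyOn_iff]
    intro ε hε
    filter_upwards [h0'.eventually_lt_const hε] with j hj x hx
    rw [dist_comm]
    exact (hwdist x hx j).trans_lt hj
  · intro x hx
    rw [tendsto_iff_norm_sub_tendsto_zero]
    refine squeeze_zero (fun _ => norm_nonneg _) (fun j => ?_) h0
    rw [norm_sub_rev]
    exact norm_sub_affineIter_le hψ hA hu hM j x hx
  · have := hwdist x hx 0
    rwa [hg'0, dist_zero_left] at this

lemma exists_ball_norm_le {X Y : Type*} [NormedAddCommGroup X] [NormedAddCommGroup Y]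
    {f : X → Y} {r : ℝ} (hr : 0 < r)
    (hf : ContinuousOn f (ball 0 r)) :
    ∃ C δ, 0 < δ ∧ δ ≤ r ∧ ∀ x ∈ ball (0 : X) δ, ‖f x‖ ≤ C := by
  have h := ((hf 0 (mem_ball_self hr)).continuousAt (ball_mem_nhds 0 hr)).norm
  obtain ⟨δ, hδ, hb⟩ := Metric.eventually_nhds_iff_ball.1
    (h.eventually_le_const (lt_add_one ‖f 0‖))
  exact ⟨_, min δ r, lt_min hδ hr, min_le_right _ _,
    fun x hx => hb x (ball_subset_ball (min_le_left _ _) hx)⟩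

/-- Bounded solutions of `u = a + A • u ∘ ψ`, with `ψ` nonexpanding at `0` and `A` contracting,
are as smooth near `0` as the data. -/
lemma contDiffOn_of_affine_eq (m : ℕ) {ψ : X → X} (hψs : ContDiff ℝ (m + 1) ψ) :
    ∀ {Y : Type u} [NormedAddCommGroup Y] [NormedSpace ℝ Y] [CompleteSpace Y]
      {a : X → Y} {A : X → Y →L[ℝ] Y} {u : X → Y} {r M : ℝ}, 0 < r →
    ContDiffOn ℝ m a (ball 0 r) → ContDiff ℝ m A →
    (∀ x ∈ ball (0 : X) r, ‖ψ x‖ ≤ ‖x‖) → (∀ x ∈ ball (0 : X) r, ‖fderiv ℝ ψ x‖ ≤ 1) →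
    (∀ x ∈ ball (0 : X) r, ‖A x‖ ≤ 1 / 2) →
    (∀ x ∈ ball (0 : X) r, u x = a x + A x (u (ψ x))) →
    (∀ x ∈ ball (0 : X) r, ‖u x‖ ≤ M) →
    ∃ δ, 0 < δ ∧ δ ≤ r ∧ ContDiffOn ℝ m u (ball 0 δ) := by
  induction m with
  | zero =>
    intro Y _ _ _ a A u r M hr ha hAs hψ hψ' hA hu hM
    refine ⟨r, hr, le_rfl, ?_⟩
    exact contDiffOn_zero.2 (continuousOn_of_affine_eq (contDiffOn_zero.1 ha)
      (contDiff_zero.1 hAs).continuousOn hψs.continuous.continuousOn hψ hA hu hM)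
  | succ m ih =>
    intro Y _ _ _ a A u r M hr ha hAs hψ hψ' hA hu hM
    push_cast at hψs ha hAs ⊢
    have hψs' : ContDiff ℝ (m + 1) ψ := hψs.of_le le_self_add
    -- The induction hypothesis is used twice: here to make `u` itself Cᵐ, because `u ∘ ψ` enters
    -- the inhomogeneous term of the equation for its derivative, and later on that derivative.
    obtain ⟨δ₁, hδ₁, hδ₁r, hum⟩ := ih hψs' hr (ha.of_le le_self_add) (hAs.of_le le_self_add)
      hψ hψ' hA hu hM
    have hsub₁ := ball_subset_ball (x := (0 : X)) hδ₁r
    have ha1 := ((contDiffOn_succ_iff_fderiv_of_isOpen isOpen_ball).1 ha)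
    have hA1 := contDiff_succ_iff_fderiv.1 hAs
    have hψ1 := contDiff_succ_iff_fderiv.1 hψs
    obtain ⟨C₁, δ₂, hδ₂, hδ₂₁, hC₁⟩ := exists_ball_norm_le hδ₁ (ha1.2.2.continuousOn.mono hsub₁)
    obtain ⟨C₂, δ₃, hδ₃, hδ₃₂, hC₂⟩ :=
      exists_ball_norm_le hδ₂ (hA1.2.2.continuous.continuousOn (s := ball 0 δ₂))
    have hsub₃₁ := ball_subset_ball (x := (0 : X)) (hδ₃₂.trans hδ₂₁)
    have hsub₃ := hsub₃₁.trans hsub₁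
    have hmaps : ∀ x ∈ ball (0 : X) δ₃, ψ x ∈ ball (0 : X) δ₃ := fun x hx => by
      have := hψ x (hsub₃ hx)
      rw [mem_ball_zero_iff] at hx ⊢
      exact this.trans_lt hx
    obtain ⟨w, D, hw, hD⟩ := exists_hasFDerivAt_of_affine_eq (C := max C₁ C₂)
      (fun x hx => ((ha1.1 x (hsub₃ hx)).differentiableAt
        (isOpen_ball.mem_nhds (hsub₃ hx))).hasFDerivAt)
      (fun x _ => (hA1.1 x).hasFDerivAt) (fun x _ => (hψ1.1 x).hasFDerivAt)
      (fun x hx => (hC₁ x (ball_subset_ball hδ₃₂ hx)).trans (le_max_left _ _))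
      (fun x hx => (hC₂ x hx).trans (le_max_right _ _))
      (fun x hx => hψ' x (hsub₃ hx)) (fun x hx => hψ x (hsub₃ hx))
      (fun x hx => hA x (hsub₃ hx)) (fun x hx => hu x (hsub₃ hx)) (fun x hx => hM x (hsub₃ hx))
    -- Differentiating the equation gives w = a₁ + A₁·w∘ψ. `A₁` still has norm at most 1/2 because
    -- the derivative of `ψ` has norm at most 1.
    let a₁ : X → X →L[ℝ] Y := fun x => fderiv ℝ a x + (fderiv ℝ A x).flip (u (ψ x))
    let A₁ : X → (X →L[ℝ] Y) →L[ℝ] (X →L[ℝ] Y) := fun x =>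
      (ContinuousLinearMap.compL ℝ X Y Y (A x)) ∘L
        ((ContinuousLinearMap.compL ℝ X X Y).flip (fderiv ℝ ψ x))
    have hA₁ : ∀ x W, A₁ x W = A x ∘L (W ∘L fderiv ℝ ψ x) := fun _ _ => rfl
    have ha₁s : ContDiffOn ℝ m a₁ (ball 0 δ₃) := by
      have h2 : ContDiffOn ℝ m (fun x => u (ψ x)) (ball 0 δ₃) :=
        (hum.mono hsub₃₁).comp (hψs'.of_le le_self_add).contDiffOn hmaps
      have hflip := LinearIsometryEquiv.contDiff (𝕜 := ℝ) (n := m) (E := X →L[ℝ] Y →L[ℝ] Y)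
        (F := Y →L[ℝ] X →L[ℝ] Y) (ContinuousLinearMap.flipₗᵢ ℝ X Y Y)
      have h3 : ContDiff ℝ m (fun x => (fderiv ℝ A x).flip) := hflip.comp hA1.2.2
      exact (ha1.2.2.mono hsub₃).add (h3.contDiffOn.clm_apply h2)
    have hA₁s : ContDiff ℝ m A₁ := by
      have h2 : ContDiff ℝ m (fun x => ContinuousLinearMap.compL ℝ X Y Y (A x)) :=
        ContDiff.continuousLinearMap_comp (F := Y →L[ℝ] Y)
          (G := (X →L[ℝ] Y) →L[ℝ] (X →L[ℝ] Y)) _ (hAs.of_le le_self_add)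
      have h3 : ContDiff ℝ m (fun x => (ContinuousLinearMap.compL ℝ X X Y).flip (fderiv ℝ ψ x)) :=
        ContDiff.continuousLinearMap_comp (F := X →L[ℝ] X)
          (G := (X →L[ℝ] Y) →L[ℝ] (X →L[ℝ] Y)) _ (hψ1.2.2.of_le le_self_add)
      exact h2.clm_comp h3
    obtain ⟨δ, hδ, hδ₃', hws⟩ := ih hψs' (Y := X →L[ℝ] Y) (a := a₁) (A := A₁) (u := w) (M := D)
      hδ₃ ha₁s hA₁s (fun x hx => hψ x (hsub₃ hx)) (fun x hx => hψ' x (hsub₃ hx))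
      (fun x hx => by
        refine ContinuousLinearMap.opNorm_le_bound _ (by norm_num) fun W => ?_
        rw [hA₁]
        refine (ContinuousLinearMap.opNorm_comp_le _ _).trans
          (mul_le_mul (hA x (hsub₃ hx)) ?_ (norm_nonneg _) (by norm_num))
        refine (ContinuousLinearMap.opNorm_comp_le _ _).trans ?_
        exact mul_le_of_le_one_right (norm_nonneg _) (hψ' x (hsub₃ hx)))
      (fun x hx => by
        have h2 : HasFDerivAt (fun x => a x + A x (u (ψ x)))
            (fderiv ℝ a x + (A x ∘L (w (ψ x) ∘L fderiv ℝ ψ x) +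
              (fderiv ℝ A x).flip (u (ψ x)))) x :=
          ((ha1.1 x (hsub₃ hx)).differentiableAt
            (isOpen_ball.mem_nhds (hsub₃ hx))).hasFDerivAt.add
            ((hA1.1 x).hasFDerivAt.clm_apply ((hw _ (hmaps x hx)).comp x (hψ1.1 x).hasFDerivAt))
        have h3 := h2.congr_of_eventuallyEq (f₁ := u)
          (Filter.eventually_of_mem (isOpen_ball.mem_nhds hx) fun y hy => hu y (hsub₃ hy))
        rw [(hw x hx).unique h3, hA₁]
        simp only [a₁]
        abel)
      hD
    refine ⟨δ, hδ, hδ₃'.trans ((hδ₃₂.trans hδ₂₁).trans hδ₁r), ?_⟩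
    rw [contDiffOn_succ_iff_fderiv_of_isOpen isOpen_ball]
    have hwδ : ∀ x ∈ ball (0 : X) δ, HasFDerivAt u (w x) x :=
      fun x hx => hw x (ball_subset_ball hδ₃' hx)
    refine ⟨fun x hx => (hwδ x hx).differentiableAt.differentiableWithinAt, by simp, ?_⟩
    exact hws.congr fun x hx => (hwδ x hx).fderiv

end Contraction

/-! ### Integral curves, integral equations and uniqueness. -/

section Sol

variable {X : Type*} [NormedAddCommGroup X] [NormedSpace ℝ X]

/-- `sol` picks a solution separately for each `t`; uniqueness makes the choice harmless. -/
lemma sol_eq_of_unique {v : ℝ → X → X} {x₀ : X} {t : ℝ} {γ : ℝ → X} (h0 : γ 0 = x₀)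
    (hγ : IsIntegralCurveOn γ v (Set.uIcc 0 t))
    (huniq : ∀ γ' : ℝ → X, γ' 0 = x₀ → IsIntegralCurveOn γ' v (Set.uIcc 0 t) → γ' t = γ t) :
    sol v x₀ t = γ t := by
  have h : t ∈ solDomain v x₀ := ⟨γ, h0, hγ⟩
  rw [sol, dif_pos h]
  exact huniq _ (Classical.choose_spec h).1 (Classical.choose_spec h).2

lemma _root_.IsIntegralCurveOn.hasDerivWithinAt_Ici {γ : ℝ → X} {v : ℝ → X → X} {a b t : ℝ}
    (h : IsIntegralCurveOn γ v (Set.Icc a b)) (ht : t ∈ Set.Ico a b) :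
    HasDerivWithinAt γ (v t (γ t)) (Set.Ici t) t :=
  (h t (Set.Ico_subset_Icc_self ht)).mono_of_mem_nhdsWithin (Icc_mem_nhdsGE_of_mem ht)

lemma _root_.IsIntegralCurveOn.hasDerivWithinAt_Iic {γ : ℝ → X} {v : ℝ → X → X} {a b t : ℝ}
    (h : IsIntegralCurveOn γ v (Set.Icc a b)) (ht : t ∈ Set.Ioc a b) :
    HasDerivWithinAt γ (v t (γ t)) (Set.Iic t) t :=
  (h t (Set.Ioc_subset_Icc_self ht)).mono_of_mem_nhdsWithin (Icc_mem_nhdsLE_of_mem ht)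

/-- Uniqueness of the solutions of an autonomous equation with `C¹` right-hand side. -/
lemma isIntegralCurveOn_eqOn_of_contDiff [FiniteDimensional ℝ X] {F : X → X}
    (hF : ContDiff ℝ 1 F) {γ γ' : ℝ → X} {t : ℝ}
    (h : IsIntegralCurveOn γ (fun _ x => F x) (Set.uIcc 0 t))
    (h' : IsIntegralCurveOn γ' (fun _ x => F x) (Set.uIcc 0 t)) (h0 : γ 0 = γ' 0) :
    Set.EqOn γ γ' (Set.uIcc 0 t) := by
  have : ProperSpace X := FiniteDimensional.proper ℝ X
  have hc := (isCompact_uIcc.image_of_continuousOn h.continuousOn).union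
    (isCompact_uIcc.image_of_continuousOn h'.continuousOn)
  obtain ⟨R, hR⟩ := hc.isBounded.subset_closedBall 0
  obtain ⟨L, hL⟩ := hF.locallyLipschitz.locallyLipschitzOn.exists_lipschitzOnWith_of_compact
    (isCompact_closedBall (0 : X) R)
  have hm : ∀ s ∈ Set.uIcc 0 t, γ s ∈ Metric.closedBall (0 : X) R :=
    fun s hs => hR (Or.inl (Set.mem_image_of_mem _ hs))
  have hm' : ∀ s ∈ Set.uIcc 0 t, γ' s ∈ Metric.closedBall (0 : X) R :=
    fun s hs => hR (Or.inr (Set.mem_image_of_mem _ hs))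
  rcases le_total 0 t with ht | ht
  · rw [Set.uIcc_of_le ht] at *
    exact ODE_solution_unique_of_mem_Icc_right (v := fun _ x => F x) (fun _ _ => hL)
      h.continuousOn (fun s hs => h.hasDerivWithinAt_Ici hs)
      (fun s hs => hm s (Set.Ico_subset_Icc_self hs))
      h'.continuousOn (fun s hs => h'.hasDerivWithinAt_Ici hs)
      (fun s hs => hm' s (Set.Ico_subset_Icc_self hs)) h0
  · rw [Set.uIcc_of_ge ht] at *
    exact ODE_solution_unique_of_mem_Icc_left (v := fun _ x => F x) (fun _ _ => hL)
      h.continuousOn (fun s hs => h.hasDerivWithinAt_Iic hs)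
      (fun s hs => hm s (Set.Ioc_subset_Icc_self hs))
      h'.continuousOn (fun s hs => h'.hasDerivWithinAt_Iic hs)
      (fun s hs => hm' s (Set.Ioc_subset_Icc_self hs)) h0

variable {T : ℝ}

lemma eq_const_add_volterra [CompleteSpace X] (hT : 0 ≤ T) {γ : ℝ → X} {v : ℝ → X → X}
    (h : IsIntegralCurveOn γ v (Set.Icc 0 T)) (x g : C(Set.Icc (0 : ℝ) T, X))
    (hx : ∀ t : Set.Icc (0 : ℝ) T, x t = γ t) (hg : ∀ t : Set.Icc (0 : ℝ) T, g t = v t (γ t)) :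
    x = ContinuousMap.const _ (γ 0) + volterra X hT g := by
  ext t
  rw [ContinuousMap.add_apply, volterra_apply, ContinuousMap.const_apply, hx]
  have hsub : Set.Icc 0 (t : ℝ) ⊆ Set.Icc 0 T := Set.Icc_subset_Icc_right t.2.2
  have h' := h.mono hsub
  have hc : Continuous fun s => g (Set.projIcc 0 T hT s) := g.continuous.comp continuous_projIcc
  rw [intervalIntegral.integral_eq_sub_of_hasDeriv_right_of_le t.2.1 h'.continuousOn
    (fun s hs => ?_) (hc.intervalIntegrable _ _), add_sub_cancel]
  rw [Set.projIcc_of_mem hT (hsub (Set.Ioo_subset_Icc_self hs)), hg]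
  exact (h'.hasDerivWithinAt_Ici (Set.Ioo_subset_Ico_self hs)).mono Set.Ioi_subset_Ici_self

lemma hasDerivWithinAt_of_eq_const_add_volterra [CompleteSpace X] (hT : 0 ≤ T)
    {x g : C(Set.Icc (0 : ℝ) T, X)}
    {y : X} (h : x = ContinuousMap.const _ y + volterra X hT g) {t : ℝ} (ht : t ∈ Set.Icc 0 T) :
    HasDerivWithinAt (fun s => x (Set.projIcc 0 T hT s)) (g ⟨t, ht⟩) (Set.Icc 0 T) t := by
  have hc : Continuous fun s => g (Set.projIcc 0 T hT s) := g.continuous.comp continuous_projIcc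
  have h1 := (intervalIntegral.integral_hasDerivAt_right (hc.intervalIntegrable 0 t)
    (hc.stronglyMeasurableAtFilter _ _) hc.continuousAt).const_add y
  rw [Set.projIcc_of_mem hT ht] at h1
  have h2 : ∀ s ∈ Set.Icc 0 T, x (Set.projIcc 0 T hT s) =
      y + ∫ r in (0 : ℝ)..s, g (Set.projIcc 0 T hT r) := by
    intro s hs
    rw [Set.projIcc_of_mem hT hs]
    exact DFunLike.congr_fun h ⟨s, hs⟩
  exact h1.hasDerivWithinAt.congr h2 (h2 t ht)

lemma apply_zero_of_eq_const_add_volterra (hT : 0 ≤ T) {x g : C(Set.Icc (0 : ℝ) T, X)}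
    {y : X} (h : x = ContinuousMap.const _ y + volterra X hT g) :
    x (Set.projIcc 0 T hT 0) = y := by
  have := DFunLike.congr_fun h ⟨0, le_rfl, hT⟩
  rw [ContinuousMap.add_apply, volterra_apply, intervalIntegral.integral_same, add_zero] at this
  rwa [Set.projIcc_of_mem hT ⟨le_rfl, hT⟩]

lemma isIntegralCurveOn_linSol [CompleteSpace X] (hT : 0 ≤ T)
    (B : C(Set.Icc (0 : ℝ) T, X →L[ℝ] X)) (y : X) :
    IsIntegralCurveOn (fun s => linSol hT B y (Set.projIcc 0 T hT s))
      (fun s x => B (Set.projIcc 0 T hT s) x) (Set.Icc 0 T) := fun s hs => by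
  have := hasDerivWithinAt_of_eq_const_add_volterra hT
    (g := pointwiseApply _ X X B (linSol hT B y)) (linSol_eq hT B y) hs
  rwa [pointwiseApply_apply, ← Set.projIcc_of_mem hT hs] at this

lemma linSol_apply_zero [CompleteSpace X] (hT : 0 ≤ T)
    (B : C(Set.Icc (0 : ℝ) T, X →L[ℝ] X)) (y : X) :
    linSol hT B y (Set.projIcc 0 T hT 0) = y :=
  apply_zero_of_eq_const_add_volterra hT (linSol_eq hT B y)

end Sol

/-! ### The flow of a forward complete vector field. -/

/-- Bounded operators, with the topology of the given norm. -/
abbrev EndC (X : Type*) [NormedAddCommGroup X] [NormedSpace ℝ X] := X →L[ℝ] X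

/-- The state space `ℝⁿ`. -/
abbrev Vec (n : ℕ) := EuclideanSpace ℝ (Fin n)

/-- Real square matrices. -/
abbrev Mat (n : ℕ) := Matrix (Fin n) (Fin n) ℝ

/-- `F` is `C¹` and its solutions are defined for all nonnegative times. -/
structure ForwardComplete (F : Vec n → Vec n) : Prop where
  contDiff : ContDiff ℝ 1 F
  mem_flowDomain : ∀ e : Vec n, ∀ t : ℝ, 0 ≤ t → t ∈ flowDomain F e

lemma flow_eq_of_isIntegralCurveOn {F : Vec n → Vec n} (hF : ContDiff ℝ 1 F) {e : Vec n}
    {γ : ℝ → Vec n} {t : ℝ} (h0 : γ 0 = e)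
    (h : IsIntegralCurveOn γ (fun _ x => F x) (Set.uIcc 0 t)) : flow F e t = γ t :=
  sol_eq_of_unique h0 h fun _ h0' h' =>
    isIntegralCurveOn_eqOn_of_contDiff hF h' h (h0'.trans h0.symm) Set.right_mem_uIcc

namespace ForwardComplete

variable {F : Vec n → Vec n} {T : ℝ}

lemma isIntegralCurveOn_flow (h : ForwardComplete F) (e : Vec n) (hT : 0 ≤ T) :
    IsIntegralCurveOn (flow F e) (fun _ x => F x) (Set.Icc 0 T) := by
  obtain ⟨γ, h0, hγ⟩ := h.mem_flowDomain e T hT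
  rw [Set.uIcc_of_le hT] at hγ
  have heq : ∀ t ∈ Set.Icc 0 T, flow F e t = γ t := fun t ht =>
    flow_eq_of_isIntegralCurveOn h.contDiff h0
      (hγ.mono (by rw [Set.uIcc_of_le ht.1]; exact Set.Icc_subset_Icc_right ht.2))
  intro t ht
  have := (hγ t ht).congr heq (heq t ht)
  rwa [← heq t ht] at this

lemma flow_zero (h : ForwardComplete F) (e : Vec n) : flow F e 0 = e :=
  flow_eq_of_isIntegralCurveOn (γ := fun _ => e) h.contDiff rfl (by
    intro t ht
    rw [Set.uIcc_self, Set.mem_singleton_iff] at ht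
    rw [ht, Set.uIcc_self]
    exact HasFDerivWithinAt.of_subsingleton Set.subsingleton_singleton)

lemma flow_add (h : ForwardComplete F) (e : Vec n) {s t : ℝ} (hs : 0 ≤ s) (ht : 0 ≤ t) :
    flow F e (s + t) = flow F (flow F e s) t := by
  refine (flow_eq_of_isIntegralCurveOn (γ := fun r => flow F e (s + r)) h.contDiff (by simp)
    ?_).symm
  rw [Set.uIcc_of_le ht]
  intro r hr
  have h1 := h.isIntegralCurveOn_flow e (add_nonneg hs ht) (s + r)
    ⟨by linarith [hr.1], by linarith [hr.2]⟩
  have h2 := h1.scomp (h := fun r => s + r) (s := Set.Icc 0 t) r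
    ((hasDerivAt_id r).const_add s).hasDerivWithinAt
    (fun x hx => ⟨by linarith [hx.1], by linarith [hx.2]⟩)
  rwa [one_smul] at h2

/-- The solution issued from `e`, as a continuous function on `[0, T]`. -/
noncomputable def flowPath (h : ForwardComplete F) (hT : 0 ≤ T) (e : Vec n) :
    C(Set.Icc (0 : ℝ) T, Vec n) :=
  ⟨fun t => flow F e t, continuousOn_iff_continuous_domRestrict.1
    (h.isIntegralCurveOn_flow e hT).continuousOn⟩

lemma flowPath_eq (h : ForwardComplete F) (hT : 0 ≤ T) (e : Vec n) :
    h.flowPath hT e = ContinuousMap.const _ e +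
      volterra (Vec n) hT ((⟨F, h.contDiff.continuous⟩ : C(Vec n, Vec n)).comp
        (h.flowPath hT e)) := by
  have := eq_const_add_volterra hT (h.isIntegralCurveOn_flow e hT) (h.flowPath hT e)
    ((⟨F, h.contDiff.continuous⟩ : C(Vec n, Vec n)).comp (h.flowPath hT e))
    (fun _ => rfl) (fun _ => rfl)
  rwa [h.flow_zero e] at this

lemma contDiff_flowPath (h : ForwardComplete F) (hT : 0 ≤ T) {m : ℕ} (hm : m ≠ 0)
    (hF : ContDiff ℝ m F) : ContDiff ℝ m (h.flowPath hT) := by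
  refine contDiff_of_eq_const_add_volterra hT hm ⟨F, h.contDiff.continuous⟩ hF _
    (h.flowPath_eq hT) fun e x hx => ?_
  ext1 t
  have hcurve : IsIntegralCurveOn (fun s => x (Set.projIcc 0 T hT s)) (fun _ x => F x)
      (Set.Icc 0 T) := fun s hs => by
    have := hasDerivWithinAt_of_eq_const_add_volterra hT hx hs
    rwa [ContinuousMap.comp_apply, ← Set.projIcc_of_mem hT hs] at this
  have h1 := flow_eq_of_isIntegralCurveOn h.contDiff
    (apply_zero_of_eq_const_add_volterra hT hx) (hcurve.mono (s' := Set.uIcc 0 (t : ℝ)) (by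
      rw [Set.uIcc_of_le t.2.1]; exact Set.Icc_subset_Icc_right t.2.2))
  rw [Set.projIcc_of_mem hT t.2] at h1
  exact h1.symm

end ForwardComplete

/-! ### The variational equation and the transition matrix. -/

/-- Matrices as continuous linear maps of the Euclidean space. -/
noncomputable def matToCLM (n : ℕ) : Mat n →L[ℝ] (Vec n →L[ℝ] Vec n) :=
  LinearMap.toContinuousLinearMap
    (Matrix.toEuclideanCLM (n := Fin n) (𝕜 := ℝ)).toAlgEquiv.toLinearMap

/-- Continuous linear maps of the Euclidean space as matrices. -/
noncomputable def clmToMat (n : ℕ) : (Vec n →L[ℝ] Vec n) →L[ℝ] Mat n :=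
  LinearMap.toContinuousLinearMap
    (Matrix.toEuclideanCLM (n := Fin n) (𝕜 := ℝ)).symm.toAlgEquiv.toLinearMap

lemma jacobian_eq (F : Vec n → Vec n) : jacobian F = fun e => clmToMat n (fderiv ℝ F e) := rfl

lemma matToCLM_jacobian (F : Vec n → Vec n) (e : Vec n) :
    matToCLM n (jacobian F e) = fderiv ℝ F e :=
  (Matrix.toEuclideanCLM (n := Fin n) (𝕜 := ℝ)).apply_symm_apply _

lemma matToCLM_mul (M N : Mat n) : matToCLM n (M * N) = matToCLM n M * matToCLM n N :=
  map_mul (Matrix.toEuclideanCLM (n := Fin n) (𝕜 := ℝ)) M N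

lemma matToCLM_one : matToCLM n 1 = 1 := map_one (Matrix.toEuclideanCLM (n := Fin n) (𝕜 := ℝ))

lemma norm_matToCLM (M : Mat n) : ‖matToCLM n M‖ = ‖M‖ := rfl

lemma contDiff_jacobian {F : Vec n → Vec n} {m : ℕ} (hF : ContDiff ℝ (m + 1) F) :
    ContDiff ℝ m (jacobian F) := by
  rw [jacobian_eq]
  exact (clmToMat n).contDiff.comp (hF.fderiv_right le_rfl)

namespace ForwardComplete

variable {F : Vec n → Vec n} {T : ℝ}

lemma continuous_jacobian (h : ForwardComplete F) : Continuous (jacobian F) :=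
  (contDiff_jacobian (m := 0) (by simpa using h.contDiff)).continuous

/-- The coefficient of the variational equation along the solution issued from `e`. -/
noncomputable def coeff (h : ForwardComplete F) (hT : 0 ≤ T) (e : Vec n) :
    C(Set.Icc (0 : ℝ) T, EndC (Mat n)) :=
  (⟨fun x => ContinuousLinearMap.mul ℝ (Mat n) (jacobian F x),
    (ContinuousLinearMap.mul ℝ (Mat n)).continuous.comp h.continuous_jacobian⟩ :
      C(Vec n, EndC (Mat n))).comp (h.flowPath hT e)

lemma coeff_apply (h : ForwardComplete F) (hT : 0 ≤ T) (e : Vec n) (t : Set.Icc (0 : ℝ) T)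
    (M : Mat n) : h.coeff hT e t M = variationalField F e t M := rfl

lemma contDiff_flowPath_of_succ (h : ForwardComplete F) (hT : 0 ≤ T) {m : ℕ}
    (hF : ContDiff ℝ (m + 1) F) : ContDiff ℝ (m + 1) (h.flowPath hT) := by
  have := h.contDiff_flowPath hT (m := m + 1) (by simp) (by exact_mod_cast hF)
  exact_mod_cast this

lemma contDiff_coeff (h : ForwardComplete F) (hT : 0 ≤ T) {m : ℕ}
    (hF : ContDiff ℝ (m + 1) F) : ContDiff ℝ m (h.coeff hT) := by
  have h1 : ContDiff ℝ m (fun x => ContinuousLinearMap.mul ℝ (Mat n) (jacobian F x)) :=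
    (ContinuousLinearMap.mul ℝ (Mat n)).contDiff.comp (contDiff_jacobian hF)
  have h2 := contDiff_comp_continuousMap (K := Set.Icc (0 : ℝ) T) m
    (⟨fun x => ContinuousLinearMap.mul ℝ (Mat n) (jacobian F x), h1.continuous⟩ :
      C(Vec n, EndC (Mat n))) h1
  exact h2.comp ((h.contDiff_flowPath_of_succ hT hF).of_le le_self_add)

lemma isIntegralCurveOn_eq_linSol (h : ForwardComplete F) (hT : 0 ≤ T) (e : Vec n)
    {γ : ℝ → Mat n} (hγ : IsIntegralCurveOn γ (variationalField F e) (Set.Icc 0 T))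
    (t : Set.Icc (0 : ℝ) T) : γ t = linSol hT (h.coeff hT e) (γ 0) t := by
  let x : C(Set.Icc (0 : ℝ) T, Mat n) :=
    ⟨fun t => γ t, continuousOn_iff_continuous_domRestrict.1 hγ.continuousOn⟩
  have := eq_linSol hT (h.coeff hT e) (γ 0) x
    (eq_const_add_volterra hT hγ x _ (fun _ => rfl) (fun _ => rfl))
  exact DFunLike.congr_fun this t

lemma variational_unique (h : ForwardComplete F) {e : Vec n}
    {γ γ' : ℝ → Mat n} {t : ℝ} (ht : 0 ≤ t)
    (hγ : IsIntegralCurveOn γ (variationalField F e) (Set.Icc 0 t))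
    (hγ' : IsIntegralCurveOn γ' (variationalField F e) (Set.Icc 0 t)) (h0 : γ 0 = γ' 0) :
    γ t = γ' t := by
  rw [h.isIntegralCurveOn_eq_linSol ht e hγ ⟨t, ht, le_rfl⟩,
    h.isIntegralCurveOn_eq_linSol ht e hγ' ⟨t, ht, le_rfl⟩, h0]

lemma isIntegralCurveOn_linSol (h : ForwardComplete F) (hT : 0 ≤ T) (e : Vec n) (M : Mat n) :
    IsIntegralCurveOn (fun s => linSol hT (h.coeff hT e) M (Set.projIcc 0 T hT s))
      (variationalField F e) (Set.Icc 0 T) := fun s hs => by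
  have := ExpStab.isIntegralCurveOn_linSol hT (h.coeff hT e) M s hs
  beta_reduce at this ⊢
  rw [h.coeff_apply] at this
  simpa only [Set.projIcc_of_mem hT hs] using this

lemma linSol_zero (h : ForwardComplete F) (hT : 0 ≤ T) (e : Vec n) (M : Mat n) :
    linSol hT (h.coeff hT e) M (Set.projIcc 0 T hT 0) = M :=
  linSol_apply_zero hT (h.coeff hT e) M

lemma mem_solDomain_variationalField (h : ForwardComplete F) (e : Vec n) (hT : 0 ≤ T) :
    T ∈ solDomain (variationalField F e) 1 :=
  ⟨_, h.linSol_zero hT e 1, by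
    rw [Set.uIcc_of_le hT]; exact h.isIntegralCurveOn_linSol hT e 1⟩

lemma transition_eq_of_isIntegralCurveOn (h : ForwardComplete F) {e : Vec n} {γ : ℝ → Mat n}
    {t : ℝ} (ht : 0 ≤ t) (h0 : γ 0 = 1)
    (hγ : IsIntegralCurveOn γ (variationalField F e) (Set.Icc 0 t)) : transition F e t = γ t := by
  rw [← Set.uIcc_of_le ht] at hγ
  refine sol_eq_of_unique h0 hγ fun γ' h0' hγ' => ?_
  rw [Set.uIcc_of_le ht] at hγ hγ'
  exact h.variational_unique ht hγ' hγ (h0'.trans h0.symm)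

/-- The transition matrix along the solution issued from `e`, as a continuous function. -/
noncomputable def transitionPath (h : ForwardComplete F) (hT : 0 ≤ T) (e : Vec n) :
    C(Set.Icc (0 : ℝ) T, Mat n) := linSol hT (h.coeff hT e) 1

lemma transitionPath_apply (h : ForwardComplete F) (hT : 0 ≤ T) (e : Vec n)
    (t : Set.Icc (0 : ℝ) T) : h.transitionPath hT e t = transition F e t := by
  rw [h.transition_eq_of_isIntegralCurveOn t.2.1 (h.linSol_zero hT e 1)
    ((h.isIntegralCurveOn_linSol hT e 1).mono (Set.Icc_subset_Icc_right t.2.2)),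
    Set.projIcc_of_mem hT t.2]
  rfl

lemma contDiff_transitionPath (h : ForwardComplete F) (hT : 0 ≤ T) {m : ℕ}
    (hF : ContDiff ℝ (m + 1) F) : ContDiff ℝ m (h.transitionPath hT) :=
  contDiff_linSol hT (h.contDiff_coeff hT hF) 1

lemma isIntegralCurveOn_transition (h : ForwardComplete F) (hT : 0 ≤ T) (e : Vec n) :
    IsIntegralCurveOn (transition F e) (variationalField F e) (Set.Icc 0 T) := by
  have heq : ∀ s ∈ Set.Icc 0 T, transition F e s =
      linSol hT (h.coeff hT e) 1 (Set.projIcc 0 T hT s) := fun s hs => by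
    rw [Set.projIcc_of_mem hT hs]
    exact (h.transitionPath_apply hT e ⟨s, hs⟩).symm
  intro t ht
  have := (h.isIntegralCurveOn_linSol hT e 1 t ht).congr heq (heq t ht)
  beta_reduce at this
  rwa [← heq t ht] at this

lemma transition_zero (h : ForwardComplete F) (e : Vec n) : transition F e 0 = 1 := by
  rw [← h.linSol_zero le_rfl e 1, Set.projIcc_of_mem le_rfl ⟨le_rfl, le_rfl⟩]
  exact (h.transitionPath_apply le_rfl e ⟨0, le_rfl, le_rfl⟩).symm

lemma continuousOn_transition (h : ForwardComplete F) (e : Vec n) :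
    ContinuousOn (transition F e) (Set.Ici 0) := by
  intro t ht
  have h0 : 0 ≤ t := ht
  exact ((h.isIntegralCurveOn_transition (by linarith) e).continuousOn t
    ⟨h0, (lt_add_one t).le⟩).mono_of_mem_nhdsWithin
      (mem_nhdsWithin.2 ⟨Set.Iio (t + 1), isOpen_Iio, lt_add_one t, fun x hx => ⟨hx.2, hx.1.le⟩⟩)

/-- Cocycle property: as functions of `t`, both sides solve the variational equation along the
trajectory of `flow F e s`, with the same initial value. -/
lemma transition_add (h : ForwardComplete F) (e : Vec n) {s t : ℝ} (hs : 0 ≤ s) (ht : 0 ≤ t) :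
    transition F e (s + t) = transition F (flow F e s) t * transition F e s := by
  refine h.variational_unique (e := flow F e s) (γ := fun r => transition F e (s + r))
    (γ' := fun r => transition F (flow F e s) r * transition F e s) ht ?_ ?_ ?_
  · intro r hr
    have h1 := h.isIntegralCurveOn_transition (add_nonneg hs ht) e (s + r)
      ⟨by linarith [hr.1], by linarith [hr.2]⟩
    have h2 := h1.scomp (h := fun r => s + r) (s := Set.Icc 0 t) r
      ((hasDerivAt_id r).const_add s).hasDerivWithinAt
      (fun x hx => ⟨by linarith [hx.1], by linarith [hx.2]⟩)
    rw [one_smul, variationalField, h.flow_add e hs hr.1] at h2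
    exact h2
  · intro r hr
    have := (h.isIntegralCurveOn_transition ht (flow F e s) r hr).mul_const (transition F e s)
    rw [variationalField, mul_assoc] at this
    exact this
  · simp [h.transition_zero]

/-- In each direction `v`, the derivative of the path and Φ(e,·)v solve the same linear integral
equation, so `eq_linSol` identifies them. -/
lemma hasFDerivAt_flow (h : ForwardComplete F) (hT : 0 ≤ T) (e : Vec n) :
    HasFDerivAt (fun e => flow F e T) (matToCLM n (transition F e T)) e := by
  have hd : Differentiable ℝ (h.flowPath hT) :=
    (h.contDiff_flowPath hT one_ne_zero (by exact_mod_cast h.contDiff)).differentiable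
      (by norm_num)
  let F' : C(Vec n, Vec n →L[ℝ] Vec n) := ⟨fderiv ℝ F, h.contDiff.continuous_fderiv one_ne_zero⟩
  have key : ∀ v, ∀ t : Set.Icc (0 : ℝ) T,
      fderiv ℝ (h.flowPath hT) e v t = matToCLM n (transition F e t) v := by
    intro v t
    let z : C(Set.Icc (0 : ℝ) T, Vec n) := ⟨fun t => matToCLM n (transition F e t) v, by
      simp_rw [← h.transitionPath_apply hT e]
      exact ((matToCLM n).continuous.comp (h.transitionPath hT e).continuous).clm_apply
        continuous_const⟩
    have hz : IsIntegralCurveOn (fun t => matToCLM n (transition F e t) v)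
        (fun t x => fderiv ℝ F (flow F e t) x) (Set.Icc 0 T) := by
      intro s hs
      have h1 := ((matToCLM n).hasFDerivAt.comp_hasDerivWithinAt s
        (h.isIntegralCurveOn_transition hT e s hs)).clm_apply (hasDerivWithinAt_const s _ v)
      rw [variationalField, matToCLM_mul, matToCLM_jacobian] at h1
      simpa using h1
    have h1 := eq_const_add_volterra hT hz z (pointwiseApply _ _ _ (F'.comp (h.flowPath hT e)) z)
      (fun _ => rfl) (fun _ => rfl)
    have h2 := fderiv_apply_eq_const_add_linVolterra hT
      (⟨F, h.contDiff.continuous⟩ : C(Vec n, Vec n)) h.contDiff (h.flowPath hT)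
      (h.flowPath_eq hT) hd e v
    have h3 := (eq_linSol hT _ _ _ h1)
    rw [h.transition_zero, matToCLM_one] at h3
    have h4 := (eq_linSol hT _ _ _ h2).trans h3.symm
    exact DFunLike.congr_fun h4 t
  let t₁ : Set.Icc (0 : ℝ) T := ⟨T, hT, le_rfl⟩
  have h1 := (ContinuousMap.evalCLM ℝ (M := Vec n) t₁).hasFDerivAt.comp e (hd e).hasFDerivAt
  have h2 : ContinuousMap.evalCLM ℝ (M := Vec n) t₁ ∘L fderiv ℝ (h.flowPath hT) e =
      matToCLM n (transition F e T) := by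
    ext1 v
    exact key v t₁
  rw [h2] at h1
  exact h1

lemma contDiff_flow (h : ForwardComplete F) (hT : 0 ≤ T) {m : ℕ} (hF : ContDiff ℝ (m + 1) F) :
    ContDiff ℝ (m + 1) (fun e => flow F e T) :=
  (ContinuousMap.evalCLM ℝ (M := Vec n) (⟨T, hT, le_rfl⟩ : Set.Icc (0 : ℝ) T)).contDiff.comp
    (h.contDiff_flowPath_of_succ hT hF)

lemma contDiff_transition (h : ForwardComplete F) (hT : 0 ≤ T) {m : ℕ}
    (hF : ContDiff ℝ (m + 1) F) : ContDiff ℝ m (fun e => transition F e T) := by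
  have := (ContinuousMap.evalCLM ℝ (M := Mat n)
    (⟨T, hT, le_rfl⟩ : Set.Icc (0 : ℝ) T)).contDiff.comp (h.contDiff_transitionPath hT hF)
  convert! this using 2 with e
  exact (h.transitionPath_apply hT e ⟨T, hT, le_rfl⟩).symm

/-- The transition matrix is invertible, with an inverse differentiable in time. -/
lemma exists_inverse_transition (h : ForwardComplete F) (hT : 0 ≤ T) (e : Vec n) :
    ∃ N : ℝ → Mat n, (∀ t ∈ Set.Icc 0 T, N t * transition F e t = 1) ∧
      IsIntegralCurveOn N (fun t M => -(M * jacobian F (flow F e t))) (Set.Icc 0 T) := by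
  let B : C(Set.Icc (0 : ℝ) T, EndC (Mat n)) :=
    (⟨fun x => -(ContinuousLinearMap.mul ℝ (Mat n)).flip (jacobian F x),
      ((ContinuousLinearMap.mul ℝ (Mat n)).flip.continuous.comp h.continuous_jacobian).neg⟩ :
        C(Vec n, EndC (Mat n))).comp (h.flowPath hT e)
  let N : ℝ → Mat n := fun s => linSol hT B 1 (Set.projIcc 0 T hT s)
  have hN : IsIntegralCurveOn N (fun t M => -(M * jacobian F (flow F e t))) (Set.Icc 0 T) := by
    intro s hs
    have := ExpStab.isIntegralCurveOn_linSol hT B 1 s hs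
    have hB : B (Set.projIcc 0 T hT s) (N s) = -(N s * jacobian F (flow F e s)) := by
      rw [Set.projIcc_of_mem hT hs]; rfl
    beta_reduce
    rw [← hB]
    exact this
  have hN0 : N 0 = 1 := linSol_apply_zero hT B 1
  refine ⟨N, ?_, hN⟩
  -- With N' = −NJ and Φ' = JΦ the product NΦ has zero derivative, hence stays equal to 1.
  have hd : IsIntegralCurveOn (fun t => N t * transition F e t) (fun _ _ => 0)
      (Set.Icc 0 T) := by
    intro s hs
    have := (hN s hs).mul (h.isIntegralCurveOn_transition hT e s hs)
    rw [variationalField] at this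
    convert! this using 1
    noncomm_ring
  intro t ht
  have := constant_of_has_deriv_right_zero hd.continuousOn
    (fun s hs => hd.hasDerivWithinAt_Ici hs) t ht
  rw [this, hN0, h.transition_zero, mul_one]

end ForwardComplete

/-! ### Congruences and the truncated integral P_T. -/

/-- Transposition as a continuous linear map. -/
noncomputable def transposeCLM (n : ℕ) : Mat n →L[ℝ] Mat n :=
  LinearMap.toContinuousLinearMap (Matrix.transposeLinearEquiv (Fin n) (Fin n) ℝ ℝ).toLinearMap

lemma transposeCLM_apply (M : Mat n) : transposeCLM n M = Mᵀ := rfl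

lemma norm_transpose (M : Mat n) : ‖Mᵀ‖ = ‖M‖ := by
  rw [← Matrix.conjTranspose_eq_transpose_of_trivial, Matrix.l2_opNorm_conjTranspose]

/-- The congruence `X ↦ Mᵀ X M`. -/
noncomputable def congruence (M : Mat n) : EndC (Mat n) :=
  ContinuousLinearMap.mul ℝ (Mat n) (transposeCLM n M) ∘L
    (ContinuousLinearMap.mul ℝ (Mat n)).flip M

lemma congruence_apply (M X : Mat n) : congruence M X = Mᵀ * X * M := (mul_assoc _ _ _).symm

lemma contDiff_congruence {m : WithTop ℕ∞} : ContDiff ℝ m (congruence (n := n)) := by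
  have h1 : ContDiff ℝ m fun M : Mat n => ContinuousLinearMap.mul ℝ (Mat n) (transposeCLM n M) :=
    (ContinuousLinearMap.mul ℝ (Mat n)).contDiff.comp (transposeCLM n).contDiff
  exact h1.clm_comp (ContinuousLinearMap.mul ℝ (Mat n)).flip.contDiff

lemma norm_transpose_mul_mul_le (M X : Mat n) : ‖Mᵀ * X * M‖ ≤ ‖M‖ ^ 2 * ‖X‖ := by
  refine (norm_mul_le _ _).trans ?_
  refine (mul_le_mul_of_nonneg_right (norm_mul_le _ _) (norm_nonneg _)).trans_eq ?_
  rw [norm_transpose]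
  ring

lemma norm_congruence_le (M : Mat n) : ‖congruence M‖ ≤ ‖M‖ ^ 2 :=
  ContinuousLinearMap.opNorm_le_bound _ (by positivity) fun X => by
    rw [congruence_apply]; exact norm_transpose_mul_mul_le M X

/-- `∫₀ᵀ Φ(e,s)ᵀ Q Φ(e,s) ds`. -/
noncomputable def lyapPartial (F : Vec n → Vec n) (Q : Mat n) (e : Vec n) (T : ℝ) : Mat n :=
  ∫ s in (0 : ℝ)..T, lyapIntegrand F Q e s

lemma lyapIntegrand_eq (F : Vec n → Vec n) (Q : Mat n) (e : Vec n) (s : ℝ) :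
    lyapIntegrand F Q e s = congruence (transition F e s) Q := (congruence_apply _ _).symm

namespace ForwardComplete

variable {F : Vec n → Vec n} {T : ℝ} (Q : Mat n)

lemma continuousOn_lyapIntegrand (h : ForwardComplete F) (e : Vec n) :
    ContinuousOn (lyapIntegrand F Q e) (Set.Ici 0) := by
  have h1 : Continuous fun M : Mat n => congruence M Q :=
    ((contDiff_congruence (m := 0)).continuous).clm_apply continuous_const
  have h2 := h1.comp_continuousOn (h.continuousOn_transition e)
  exact h2.congr fun s _ => lyapIntegrand_eq F Q e s

lemma intervalIntegrable_lyapIntegrand (h : ForwardComplete F) (e : Vec n) {a b : ℝ} (ha : 0 ≤ a)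
    (hb : 0 ≤ b) : IntervalIntegrable (lyapIntegrand F Q e) MeasureTheory.volume a b :=
  ((h.continuousOn_lyapIntegrand Q e).mono fun _ hs => (le_min ha hb).trans hs.1).intervalIntegrable

lemma contDiff_lyapPartial (h : ForwardComplete F) (hT : 0 ≤ T) {m : ℕ}
    (hF : ContDiff ℝ (m + 1) F) : ContDiff ℝ m (fun e => lyapPartial F Q e T) := by
  have hg : ContDiff ℝ m fun M : Mat n => congruence M Q :=
    contDiff_congruence.clm_apply contDiff_const
  let g : C(Mat n, Mat n) := ⟨_, hg.continuous⟩
  have h1 : ContDiff ℝ m fun x : C(Set.Icc (0 : ℝ) T, Mat n) => g.comp x :=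
    contDiff_comp_continuousMap m g hg
  have h2 := (volterra (Mat n) hT).contDiff.comp (h1.comp (h.contDiff_transitionPath hT hF))
  have h3 := (ContinuousMap.evalCLM ℝ (M := Mat n)
    (⟨T, hT, le_rfl⟩ : Set.Icc (0 : ℝ) T)).contDiff.comp h2
  convert! h3 using 2 with e
  refine intervalIntegral.integral_congr fun s hs => ?_
  rw [Set.uIcc_of_le hT] at hs
  change lyapIntegrand F Q e s = congruence (h.transitionPath hT e (Set.projIcc 0 T hT s)) Q
  rw [Set.projIcc_of_mem hT hs, h.transitionPath_apply hT e ⟨s, hs⟩, lyapIntegrand_eq]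

lemma lyapPartial_add (h : ForwardComplete F) (e : Vec n) {S : ℝ} (hT : 0 ≤ T) (hS : 0 ≤ S) :
    lyapPartial F Q e (T + S) = lyapPartial F Q e T +
      congruence (transition F e T) (lyapPartial F Q (flow F e T) S) := by
  rw [lyapPartial, ← intervalIntegral.integral_add_adjacent_intervals (b := T)
    (h.intervalIntegrable_lyapIntegrand Q e le_rfl hT)
    (h.intervalIntegrable_lyapIntegrand Q e hT (add_nonneg hT hS)), lyapPartial, lyapPartial,
    ← ContinuousLinearMap.intervalIntegral_comp_comm _
      (h.intervalIntegrable_lyapIntegrand Q _ le_rfl hS)]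
  congr 1
  have h1 := intervalIntegral.integral_comp_add_left (a := 0) (b := S) (lyapIntegrand F Q e) T
  rw [add_zero] at h1
  rw [← h1]
  refine intervalIntegral.integral_congr fun s hs => ?_
  rw [Set.uIcc_of_le hS] at hs
  simp only [congruence_apply, lyapIntegrand, h.transition_add e hT hs.1, Matrix.transpose_mul,
    Matrix.mul_assoc]

end ForwardComplete

/-! ### Convergence, functional equation and smoothness of P. -/

/-- A forward complete vector field all of whose solutions tend to `0`, with exponentially
decaying transition matrices. -/
structure Stable (F : Vec n → Vec n) : Prop extends ForwardComplete F where
  eq_zero : F 0 = 0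
  tendsto_flow : ∀ e, Filter.Tendsto (flow F e) Filter.atTop (nhds 0)
  norm_transition_le : ∀ e, ∃ c μ : ℝ, 0 < μ ∧
    ∀ t, 0 ≤ t → ‖transition F e t‖ ≤ c * Real.exp (-μ * t)

namespace Stable

open Filter Topology Metric

variable {F : Vec n → Vec n} {T : ℝ} (Q : Mat n)

lemma integrableOn_lyapIntegrand (h : Stable F) (e : Vec n) :
    MeasureTheory.IntegrableOn (lyapIntegrand F Q e) (Set.Ioi 0) := by
  obtain ⟨c, μ, hμ, hc⟩ := h.norm_transition_le e
  have h1 := (integrableOn_exp_mul_Ioi (a := -(2 * μ)) (by linarith) 0).const_mul (c ^ 2 * ‖Q‖)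
  refine MeasureTheory.Integrable.mono' h1 (((h.continuousOn_lyapIntegrand Q e).mono
    Set.Ioi_subset_Ici_self).aestronglyMeasurable measurableSet_Ioi) ?_
  filter_upwards [MeasureTheory.ae_restrict_mem measurableSet_Ioi] with s hs
  refine (norm_transpose_mul_mul_le _ _).trans ?_
  have h2 := pow_le_pow_left₀ (norm_nonneg _) (hc s (le_of_lt hs)) 2
  refine (mul_le_mul_of_nonneg_right h2 (norm_nonneg Q)).trans_eq ?_
  rw [mul_pow, ← Real.exp_nat_mul]
  have : ((2 : ℕ) : ℝ) * (-μ * s) = -(2 * μ) * s := by push_cast; ring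
  rw [this]
  ring

lemma tendsto_lyapPartial (h : Stable F) (e : Vec n) :
    Tendsto (fun T => lyapPartial F Q e T) atTop (𝓝 (lyapMatrix F Q e)) :=
  MeasureTheory.intervalIntegral_tendsto_integral_Ioi 0 (h.integrableOn_lyapIntegrand Q e)
    tendsto_id

/-- The limit S → ∞ of `lyapPartial_add`, by continuity of the congruence. -/
lemma lyapMatrix_eq (h : Stable F) (hT : 0 ≤ T) (e : Vec n) :
    lyapMatrix F Q e = lyapPartial F Q e T +
      congruence (transition F e T) (lyapMatrix F Q (flow F e T)) := by
  have h1 := (h.tendsto_lyapPartial Q e).comp (tendsto_atTop_add_const_left atTop T tendsto_id)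
  have h2 : Tendsto (fun S => lyapPartial F Q e T +
      congruence (transition F e T) (lyapPartial F Q (flow F e T) S)) atTop
      (𝓝 (lyapPartial F Q e T +
        congruence (transition F e T) (lyapMatrix F Q (flow F e T)))) :=
    tendsto_const_nhds.add (((congruence (transition F e T)).continuous.tendsto _).comp
      (h.tendsto_lyapPartial Q _))
  refine tendsto_nhds_unique h1 (h2.congr' ?_)
  filter_upwards [eventually_ge_atTop 0] with S hS
  exact (h.lyapPartial_add Q e hT hS).symm

lemma flow_map_zero (h : Stable F) : flow F 0 T = 0 :=
  flow_eq_of_isIntegralCurveOn (γ := fun _ => 0) h.contDiff rfl fun t _ => by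
    beta_reduce; rw [h.eq_zero]; exact hasDerivWithinAt_const _ _ _

/-- A time at which the flow contracts a neighbourhood of the origin. -/
lemma exists_contracting_time (h : Stable F) : ∃ T r : ℝ, 0 < T ∧ 0 < r ∧
    ∀ x ∈ ball (0 : Vec n) r, ‖transition F x T‖ ≤ 1 / 2 ∧ ‖flow F x T‖ ≤ ‖x‖ := by
  obtain ⟨c, μ, hμ, hc⟩ := h.norm_transition_le 0
  have h1 : Tendsto (fun t : ℝ => c * Real.exp (-μ * t)) atTop (𝓝 0) := by
    have := (Real.tendsto_exp_atBot.comp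
      (tendsto_id.const_mul_atTop_of_neg (neg_lt_zero.2 hμ))).const_mul c
    simpa using this
  obtain ⟨T, hT, hT'⟩ := ((h1.eventually_lt_const (show (0 : ℝ) < 1 / 2 by norm_num)).and
    (eventually_gt_atTop 0)).exists
  have hcont : Continuous fun x => transition F x T :=
    (h.contDiff_transition hT'.le (m := 0) (by simpa using h.contDiff)).continuous
  obtain ⟨r, hr, hb⟩ := Metric.eventually_nhds_iff_ball.1
    ((hcont.continuousAt (x := 0)).norm.eventually_lt_const ((hc T hT'.le).trans_lt hT))
  refine ⟨T, r, hT', hr, fun x hx => ⟨(hb x hx).le, ?_⟩⟩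
  -- The derivative of the time-`T` flow is Φ(·,T), and 0 is fixed, so the mean value inequality
  -- bounds |E(x,T)| by |x|.
  have h2 := (convex_ball (0 : Vec n) r).norm_image_sub_le_of_norm_hasFDerivWithin_le
    (f := fun e => flow F e T) (f' := fun e => matToCLM n (transition F e T)) (C := 1)
    (fun y _ => (h.hasFDerivAt_flow hT'.le y).hasFDerivWithinAt)
    (fun y hy => (norm_matToCLM _).trans_le ((hb y hy).le.trans (by norm_num)))
    (mem_ball_self hr) hx
  rwa [h.flow_map_zero, sub_zero, sub_zero, one_mul] at h2

/-- Supplies the local boundedness required by the contraction argument, which the pointwise decay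
of Φ does not give. If C bounds P_T on the ball, then 2C bounds P at every truncation jT, since C +
(1/4)·2C ≤ 2C; the bound passes to the limit. -/
lemma exists_lyapMatrix_bound (h : Stable F) {r : ℝ} (hT : 0 < T) (hr : 0 < r)
    (hΦ : ∀ x ∈ ball (0 : Vec n) r, ‖transition F x T‖ ≤ 1 / 2)
    (hψ : ∀ x ∈ ball (0 : Vec n) r, ‖flow F x T‖ ≤ ‖x‖) :
    ∃ C δ, 0 < δ ∧ δ ≤ r ∧ ∀ x ∈ ball (0 : Vec n) δ, ‖lyapMatrix F Q x‖ ≤ C := by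
  obtain ⟨C, δ, hδ, hδr, hC⟩ := exists_ball_norm_le hr
    (h.contDiff_lyapPartial Q hT.le (m := 0) (by simpa using h.contDiff)).continuous.continuousOn
  refine ⟨2 * C, δ, hδ, hδr, fun x hx => ?_⟩
  have hC0 : 0 ≤ C := (norm_nonneg _).trans (hC 0 (mem_ball_self hδ))
  have key : ∀ j : ℕ, ∀ x ∈ ball (0 : Vec n) δ, ‖lyapPartial F Q x (j * T)‖ ≤ 2 * C := by
    intro j
    induction j with
    | zero => intro x _; simpa [lyapPartial] using hC0
    | succ j ih =>
      intro x hx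
      have hxr := ball_subset_ball hδr hx
      have hx' : flow F x T ∈ ball (0 : Vec n) δ := by
        have := hψ x hxr
        rw [mem_ball_zero_iff] at hx ⊢
        exact this.trans_lt hx
      have e1 : ((j + 1 : ℕ) : ℝ) * T = T + j * T := by push_cast; ring
      rw [e1, h.lyapPartial_add Q x hT.le (by positivity)]
      refine (norm_add_le _ _).trans ?_
      have h1 : ‖congruence (transition F x T)‖ ≤ (1 / 2) ^ 2 := (norm_congruence_le _).trans
        (pow_le_pow_left₀ (norm_nonneg _) (hΦ x hxr) 2)
      have h2 := (congruence (transition F x T)).le_of_opNorm_le_of_le h1 (ih _ hx')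
      have h3 := hC x hx
      norm_num at h2
      linarith
  have hlim := ((h.tendsto_lyapPartial Q x).comp
    (tendsto_natCast_atTop_atTop.atTop_mul_const hT)).norm
  exact le_of_tendsto' hlim fun j => key j x hx

lemma exists_contDiffOn_lyapMatrix (h : Stable F) {m : ℕ} (hF : ContDiff ℝ (m + 1) F) :
    ∃ δ, 0 < δ ∧ ContDiffOn ℝ m (lyapMatrix F Q) (ball 0 δ) := by
  obtain ⟨T, r, hT, hr, hTr⟩ := h.exists_contracting_time
  obtain ⟨C, δ, hδ, hδr, hC⟩ := h.exists_lyapMatrix_bound Q hT hr (fun x hx => (hTr x hx).1)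
    (fun x hx => (hTr x hx).2)
  have hsub := ball_subset_ball (x := (0 : Vec n)) hδr
  have hcongr : ContDiff ℝ m fun x => congruence (transition F x T) :=
    contDiff_congruence.comp (h.contDiff_transition hT.le hF)
  obtain ⟨δ', hδ', -, hs⟩ := contDiffOn_of_affine_eq m (h.contDiff_flow hT.le hF) hδ
    (h.contDiff_lyapPartial Q hT.le hF).contDiffOn hcongr
    (fun x hx => (hTr x (hsub hx)).2)
    (fun x hx => by
      rw [(h.hasFDerivAt_flow hT.le x).fderiv, norm_matToCLM]
      exact (hTr x (hsub hx)).1.trans (by norm_num))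
    (fun x hx => (norm_congruence_le _).trans
      ((pow_le_pow_left₀ (norm_nonneg _) (hTr x (hsub hx)).1 2).trans (by norm_num)))
    (fun x _ => h.lyapMatrix_eq Q hT.le x) hC
  exact ⟨δ', hδ', hs⟩

/-- Once `T` is so large that E(e,T) lies in the ball where P is smooth, the functional equation
expresses P near `e` through smooth functions. -/
lemma contDiff_lyapMatrix (h : Stable F) {m : ℕ} (hF : ContDiff ℝ (m + 1) F) :
    ContDiff ℝ m (lyapMatrix F Q) := by
  obtain ⟨δ, hδ, hs⟩ := h.exists_contDiffOn_lyapMatrix Q hF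
  rw [contDiff_iff_contDiffAt]
  intro e
  obtain ⟨T, hTmem, hT⟩ := (((h.tendsto_flow e).eventually (ball_mem_nhds 0 hδ)).and
    (eventually_ge_atTop 0)).exists
  have h1 : ContDiffAt ℝ m (fun x => lyapMatrix F Q (flow F x T)) e :=
    ContDiffAt.comp (g := lyapMatrix F Q) (f := fun x => flow F x T) e
      (hs.contDiffAt (isOpen_ball.mem_nhds hTmem))
      ((h.contDiff_flow hT hF).of_le le_self_add).contDiffAt
  have h2 : ContDiff ℝ m fun x => congruence (transition F x T) :=
    contDiff_congruence.comp (h.contDiff_transition hT hF)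
  have h3 := (h.contDiff_lyapPartial Q hT hF).contDiffAt.add (h2.contDiffAt.clm_apply h1)
  exact h3.congr_of_eventuallyEq (Eventually.of_forall fun x => h.lyapMatrix_eq Q hT x)

end Stable

/-! ### Quadratic forms and the bounds on P. -/

/-- The value at `x` of the quadratic form of a matrix, as a linear function of the matrix. -/
noncomputable def quad (x : Vec n) : Mat n →L[ℝ] ℝ :=
  innerSL ℝ x ∘L ContinuousLinearMap.apply ℝ (Vec n) x ∘L matToCLM n

lemma quad_apply (x : Vec n) (M : Mat n) : quad x M = inner ℝ x (matToCLM n M x) := rfl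

lemma quad_eq_dotProduct (x : Vec n) (M : Mat n) : quad x M = x.ofLp ⬝ᵥ M *ᵥ x.ofLp :=
  Matrix.inner_toEuclideanCLM M x x

lemma quad_transpose_mul_mul (x : Vec n) (M X : Mat n) :
    quad x (Mᵀ * X * M) = quad (matToCLM n M x) X := by
  have h : (matToCLM n M x).ofLp = M *ᵥ x.ofLp := rfl
  rw [quad_eq_dotProduct, quad_eq_dotProduct, h, Matrix.mul_assoc, ← Matrix.mulVec_mulVec,
    ← Matrix.mulVec_mulVec, Matrix.dotProduct_mulVec, Matrix.vecMul_transpose]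

lemma quad_one (x : Vec n) : quad x 1 = ‖x‖ ^ 2 := by
  rw [quad_apply, matToCLM_one]
  exact real_inner_self_eq_norm_sq x

lemma quad_le_norm (x : Vec n) (M : Mat n) : quad x M ≤ ‖M‖ * ‖x‖ ^ 2 := by
  rw [quad_apply]
  refine (real_inner_le_norm _ _).trans ?_
  have := (matToCLM n M).le_opNorm x
  rw [norm_matToCLM] at this
  nlinarith [norm_nonneg x]

lemma quad_smul_left (c : ℝ) (x : Vec n) (M : Mat n) : quad (c • x) M = c ^ 2 * quad x M := by
  rw [quad_apply, quad_apply, map_smul, inner_smul_left, inner_smul_right]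
  simp
  ring

lemma le_of_quad_le {A B : Mat n} (hA : Aᵀ = A) (hB : Bᵀ = B) (h : ∀ x, quad x A ≤ quad x B) :
    A ≤ B := by
  rw [Matrix.le_iff]
  refine Matrix.PosSemidef.of_dotProduct_mulVec_nonneg ?_ fun x => ?_
  · rw [Matrix.IsHermitian, Matrix.conjTranspose_eq_transpose_of_trivial, Matrix.transpose_sub,
      hA, hB]
  · have h1 := sub_nonneg.2 (h (WithLp.toLp 2 x))
    rw [← map_sub, quad_eq_dotProduct] at h1
    simpa using h1

lemma quad_pos_of_posDef {Q : Mat n} (hQ : Q.PosDef) {x : Vec n} (hx : x ≠ 0) : 0 < quad x Q := by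
  rw [quad_eq_dotProduct]
  have h : x.ofLp ≠ 0 := fun h0 => hx (by ext i; simpa using congrFun h0 i)
  simpa using hQ.dotProduct_mulVec_pos h

lemma quad_nonneg_of_posDef {Q : Mat n} (hQ : Q.PosDef) (x : Vec n) : 0 ≤ quad x Q := by
  rcases eq_or_ne x 0 with rfl | hx
  · rw [quad_apply, inner_zero_left]
  · exact (quad_pos_of_posDef hQ hx).le

namespace Stable

open Filter Topology Metric

variable {F : Vec n → Vec n} {T : ℝ} {Q : Mat n}

lemma transpose_lyapMatrix (h : Stable F) (hQ : Q.PosDef) (e : Vec n) :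
    (lyapMatrix F Q e)ᵀ = lyapMatrix F Q e := by
  have hQt : Qᵀ = Q := by
    rw [← Matrix.conjTranspose_eq_transpose_of_trivial]; exact hQ.isHermitian
  have h1 := (transposeCLM n).integral_comp_comm (h.integrableOn_lyapIntegrand Q e)
  refine h1.symm.trans (MeasureTheory.integral_congr_ae (Eventually.of_forall fun s => ?_))
  simp only [transposeCLM_apply, lyapIntegrand, Matrix.transpose_mul, Matrix.transpose_transpose,
    hQt, Matrix.mul_assoc]

lemma quad_lyapMatrix_nonneg (h : Stable F) (hQ : Q.PosDef) (e x : Vec n) :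
    0 ≤ quad x (lyapMatrix F Q e) := by
  rw [lyapMatrix, ← (quad x).integral_comp_comm (h.integrableOn_lyapIntegrand Q e)]
  refine MeasureTheory.integral_nonneg fun s => ?_
  rw [lyapIntegrand, quad_transpose_mul_mul]
  exact quad_nonneg_of_posDef hQ _

/-- The part of the integral over [0,1] is already positive, as Φ(e,s) is injective; the rest is
nonnegative. -/
lemma quad_lyapMatrix_pos (h : Stable F) (hQ : Q.PosDef) (e : Vec n) {x : Vec n} (hx : x ≠ 0) :
    0 < quad x (lyapMatrix F Q e) := by
  rw [h.lyapMatrix_eq Q zero_le_one e, map_add, congruence_apply, quad_transpose_mul_mul]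
  refine add_pos_of_pos_of_nonneg ?_ (h.quad_lyapMatrix_nonneg hQ _ _)
  have hint := h.intervalIntegrable_lyapIntegrand Q e le_rfl zero_le_one
  rw [lyapPartial, ← (quad x).intervalIntegral_comp_comm hint]
  refine intervalIntegral.intervalIntegral_pos_of_pos_on
    ⟨(quad x).integrable_comp hint.1, (quad x).integrable_comp hint.2⟩ (fun s hs => ?_) one_pos
  rw [lyapIntegrand, quad_transpose_mul_mul]
  refine quad_pos_of_posDef hQ fun h0 => hx ?_
  obtain ⟨N, hN, -⟩ := h.exists_inverse_transition zero_le_one e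
  have h1 := congrArg (fun M => matToCLM n M x) (hN s ⟨hs.1.le, hs.2.le⟩)
  rw [matToCLM_mul, matToCLM_one, mul_apply_eq_comp, h0] at h1
  exact h1.symm.trans (map_zero (matToCLM n (N s)))

lemma exists_bounds_lyapMatrix (h : Stable F) (hQ : Q.PosDef) :
    ∃ p q : ℝ → ℝ, AntitoneOn p (Set.Ici 0) ∧ MonotoneOn q (Set.Ici 0) ∧
      ∀ e : Vec n, 0 < p ‖e‖ ∧ p ‖e‖ • (1 : Mat n) ≤ lyapMatrix F Q e ∧
        lyapMatrix F Q e ≤ q ‖e‖ • (1 : Mat n) := by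
  have hP : Continuous (lyapMatrix F Q) :=
    (h.contDiff_lyapMatrix Q (m := 0) (by simpa using h.contDiff)).continuous
  let f : Vec n × Vec n → ℝ := fun z => (quad z.2 (lyapMatrix F Q z.1))⁻¹
  let K : ℝ → Set (Vec n × Vec n) := fun r => closedBall 0 r ×ˢ sphere 0 1
  have hne : ∀ x ∈ sphere (0 : Vec n) 1, x ≠ 0 := fun x hx h0 => by
    rw [h0, mem_sphere_zero_iff_norm, norm_zero] at hx
    exact zero_ne_one hx
  have hf : ∀ r, ContinuousOn f (K r) := fun r => by
    refine ContinuousOn.inv₀ (Continuous.continuousOn ?_) fun z hz =>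
      (h.quad_lyapMatrix_pos hQ z.1 (hne _ hz.2)).ne'
    exact continuous_snd.inner
      (((matToCLM n).continuous.comp (hP.comp continuous_fst)).clm_apply continuous_snd)
  have hKc : ∀ r, IsCompact (K r) := fun r => (isCompact_closedBall 0 r).prod (isCompact_sphere 0 1)
  have hf0 : ∀ r, ∀ y ∈ f '' K r, 0 ≤ y := by
    rintro r _ ⟨z, hz, rfl⟩
    exact inv_nonneg.2 (h.quad_lyapMatrix_nonneg hQ _ _)
  have hbdd : ∀ r, BddAbove (f '' K r) := fun r => (hKc r).bddAbove_image (hf r)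
  have hs0 : ∀ r, 0 ≤ sSup (f '' K r) := fun r => Real.sSup_nonneg (hf0 r)
  have hbdd' : ∀ r, BddAbove ((fun e => ‖lyapMatrix F Q e‖) '' closedBall 0 r) := fun r =>
    (isCompact_closedBall 0 r).bddAbove_image hP.norm.continuousOn
  have hsymm : ∀ c : ℝ, (c • (1 : Mat n))ᵀ = c • (1 : Mat n) := fun c => by
    rw [Matrix.transpose_smul, Matrix.transpose_one]
  -- Suprema over growing compact sets make both bounds monotone. The summand 1 keeps the lower
  -- bound positive even for n = 0, where the sphere is empty and `sSup ∅ = 0`.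
  refine ⟨fun r => (1 + sSup (f '' K r))⁻¹,
    fun r => sSup ((fun e => ‖lyapMatrix F Q e‖) '' closedBall 0 r), ?_, ?_, fun e => ⟨?_, ?_, ?_⟩⟩
  · intro r _ r' _ hrr'
    have hsub : f '' K r ⊆ f '' K r' :=
      Set.image_mono (Set.prod_mono_left (closedBall_subset_closedBall hrr'))
    have h1 := hs0 r
    refine inv_anti₀ (by linarith) (add_le_add_right ?_ 1)
    exact Real.sSup_le (fun y hy => le_csSup (hbdd r') (hsub hy)) (hs0 r')
  · intro r _ r' _ hrr'
    exact Real.sSup_le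
      (fun y hy => le_csSup (hbdd' r') (Set.image_mono (closedBall_subset_closedBall hrr') hy))
      (Real.sSup_nonneg (by rintro _ ⟨z, -, rfl⟩; exact norm_nonneg _))
  · have h1 := hs0 ‖e‖
    exact inv_pos.2 (by linarith)
  · refine le_of_quad_le (hsymm _) (h.transpose_lyapMatrix hQ e) fun x => ?_
    rw [map_smul, quad_one, smul_eq_mul]
    rcases eq_or_ne x 0 with rfl | hx
    · simpa using h.quad_lyapMatrix_nonneg hQ e 0
    have hx0 : ‖x‖ ≠ 0 := norm_ne_zero_iff.2 hx
    have hu : ‖x‖⁻¹ • x ∈ sphere (0 : Vec n) 1 := by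
      rw [mem_sphere_zero_iff_norm, norm_smul, norm_inv, norm_norm, inv_mul_cancel₀ hx0]
    have hpos := h.quad_lyapMatrix_pos hQ e (hne _ hu)
    have h1 : f (e, ‖x‖⁻¹ • x) ≤ sSup (f '' K ‖e‖) :=
      le_csSup (hbdd _) (Set.mem_image_of_mem f ⟨by simp, hu⟩)
    have h2 : (1 + sSup (f '' K ‖e‖))⁻¹ ≤ quad (‖x‖⁻¹ • x) (lyapMatrix F Q e) :=
      inv_le_of_inv_le₀ hpos (by linarith [show f (e, ‖x‖⁻¹ • x) =
        (quad (‖x‖⁻¹ • x) (lyapMatrix F Q e))⁻¹ from rfl])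
    have h3 : quad x (lyapMatrix F Q e) = ‖x‖ ^ 2 * quad (‖x‖⁻¹ • x) (lyapMatrix F Q e) := by
      rw [← quad_smul_left, smul_inv_smul₀ hx0]
    rw [h3, mul_comm]
    exact mul_le_mul_of_nonneg_left h2 (by positivity)
  · refine le_of_quad_le (h.transpose_lyapMatrix hQ e) (hsymm _) fun x => ?_
    rw [map_smul, quad_one, smul_eq_mul]
    refine (quad_le_norm _ _).trans (mul_le_mul_of_nonneg_right ?_ (by positivity))
    exact le_csSup (hbdd' _) (Set.mem_image_of_mem (fun e => ‖lyapMatrix F Q e‖) (by simp))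

/-! ### The derivative of P along solutions. -/

/-- Along a solution, `P` is differentiable at positive times. -/
lemma hasDerivAt_lyapMatrix_flow (h : Stable F) (Q : Mat n) (y : Vec n) {τ : ℝ} (hτ : 0 < τ) :
    HasDerivAt (fun t => lyapMatrix F Q (flow F y t))
      (-(lyapMatrix F Q (flow F y τ) * jacobian F (flow F y τ)) -
        (jacobian F (flow F y τ))ᵀ * lyapMatrix F Q (flow F y τ) - Q) τ := by
  have hT : 0 ≤ τ + 1 := by linarith
  have hnhds : Set.Icc 0 (τ + 1) ∈ 𝓝 τ := Icc_mem_nhds hτ (lt_add_one τ)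
  obtain ⟨N, hN, hNd⟩ := h.exists_inverse_transition hT y
  -- The functional equation solved for P(E(y,t)), with `N` the inverse of Φ: the right-hand side is
  -- visibly differentiable in `t`, without any differentiability of P.
  have heq : ∀ t ∈ Set.Icc 0 (τ + 1), lyapMatrix F Q (flow F y t) =
      (N t)ᵀ * (lyapMatrix F Q y - lyapPartial F Q y t) * N t := by
    intro t ht
    have h1 := mul_eq_one_comm.1 (hN t ht)
    have h2 := congrArg Matrix.transpose h1
    rw [Matrix.transpose_mul, Matrix.transpose_one] at h2
    rw [h.lyapMatrix_eq Q ht.1 y, add_sub_cancel_left, congruence_apply]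
    calc lyapMatrix F Q (flow F y t)
        = ((N t)ᵀ * (transition F y t)ᵀ) * lyapMatrix F Q (flow F y t) *
          (transition F y t * N t) := by rw [h1, h2, one_mul, mul_one]
      _ = _ := by noncomm_ring
  have hN' : HasDerivAt N (-(N τ * jacobian F (flow F y τ))) τ :=
    (hNd τ (mem_of_mem_nhds hnhds)).hasDerivAt hnhds
  have hNt : HasDerivAt (fun t => (N t)ᵀ) (-(N τ * jacobian F (flow F y τ)))ᵀ τ :=
    (transposeCLM n).hasFDerivAt.comp_hasDerivAt τ hN'
  have hci : ContinuousOn (lyapIntegrand F Q y) (Set.Ici 0) := h.continuousOn_lyapIntegrand Q y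
  have hI : HasDerivAt (fun t => lyapPartial F Q y t) (lyapIntegrand F Q y τ) τ :=
    intervalIntegral.integral_hasDerivAt_right
      (h.intervalIntegrable_lyapIntegrand Q y le_rfl hτ.le)
      ((hci.mono Set.Ioi_subset_Ici_self).stronglyMeasurableAtFilter isOpen_Ioi τ hτ)
      (hci.continuousAt (Ici_mem_nhds hτ))
  have hmain : HasDerivAt (fun t => (N t)ᵀ * (lyapMatrix F Q y - lyapPartial F Q y t) * N t) _ τ :=
    (hNt.fun_mul (hI.const_sub (lyapMatrix F Q y))).fun_mul hN'
  refine (hmain.congr_of_eventuallyEq (eventually_of_mem hnhds heq)).congr_deriv ?_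
  have h1 := mul_eq_one_comm.1 (hN τ (mem_of_mem_nhds hnhds))
  have h2 := congrArg Matrix.transpose h1
  rw [Matrix.transpose_mul, Matrix.transpose_one] at h2
  rw [heq τ (mem_of_mem_nhds hnhds), lyapIntegrand, Matrix.transpose_neg, Matrix.transpose_mul]
  have h3 : (N τ)ᵀ * ((transition F y τ)ᵀ * Q * transition F y τ) * N τ = Q := by
    calc _ = ((N τ)ᵀ * (transition F y τ)ᵀ) * Q * (transition F y τ * N τ) := by noncomm_ring
      _ = Q := by rw [h1, h2, one_mul, mul_one]
  rw [add_mul, mul_neg, neg_mul _ (N τ), h3]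
  noncomm_ring

/-- Time 0 is made interior: a local solution through `e` is followed back to `γ (-τ)`, and from
there `e` is reached at the positive time `τ`. -/
lemma hasDerivAt_lyapMatrix_flow_zero (h : Stable F) (Q : Mat n) (e : Vec n) :
    HasDerivAt (fun t => lyapMatrix F Q (flow F e t))
      (-(lyapMatrix F Q e * jacobian F e) - (jacobian F e)ᵀ * lyapMatrix F Q e - Q) 0 := by
  obtain ⟨γ, h0, ε, hε, hγ⟩ :=
    h.contDiff.contDiffAt (x := e).exists_forall_mem_closedBall_exists_eq_forall_mem_Ioo_hasDerivAt₀
      0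
  rw [zero_sub, zero_add] at hγ
  set τ := ε / 2 with hτ
  have hτ0 : 0 < τ := half_pos hε
  have hτε : ε = 2 * τ := by rw [hτ]; ring
  have hfe : ∀ t ∈ Set.Ioo (-τ) τ, flow F e t = γ t := fun t ht =>
    flow_eq_of_isIntegralCurveOn h.contDiff h0 fun s hs => by
      have h1 := Set.uIcc_subset_Icc (a₂ := -τ) (b₂ := τ) ⟨by linarith, hτ0.le⟩
        (Set.Ioo_subset_Icc_self ht) hs
      exact (hγ s ⟨by linarith [h1.1], by linarith [h1.2]⟩).hasDerivWithinAt
  have hfy : ∀ t ∈ Set.Ioo (-τ) τ, flow F (γ (-τ)) (t + τ) = γ t := fun t ht => by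
    have h1 : flow F (γ (-τ)) (t + τ) = γ (t + τ - τ) :=
      flow_eq_of_isIntegralCurveOn (γ := fun s => γ (s - τ)) h.contDiff (by simp) fun s hs => by
        rw [Set.uIcc_of_le (by linarith [ht.1])] at hs
        have h2 := (hγ (s - τ) ⟨by linarith [hs.1], by linarith [hs.2, ht.2]⟩).scomp s
          ((hasDerivAt_id s).sub_const τ)
        rw [one_smul] at h2
        exact h2.hasDerivWithinAt
    rwa [add_sub_cancel_right] at h1
  have hmem : (0 : ℝ) ∈ Set.Ioo (-τ) τ := ⟨by linarith, hτ0⟩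
  have hy : flow F (γ (-τ)) τ = e := by
    have := hfy 0 hmem
    rwa [zero_add, h0] at this
  have h1 := h.hasDerivAt_lyapMatrix_flow Q (γ (-τ)) hτ0
  rw [hy] at h1
  have h2 : HasDerivAt (fun t => lyapMatrix F Q (flow F (γ (-τ)) (t + τ)))
      (-(lyapMatrix F Q e * jacobian F e) - (jacobian F e)ᵀ * lyapMatrix F Q e - Q) 0 := by
    refine HasDerivAt.comp_add_const 0 τ (by rwa [zero_add])
  refine h2.congr_of_eventuallyEq ?_
  filter_upwards [Ioo_mem_nhds hmem.1 hmem.2] with t ht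
  rw [hfe t ht, hfy t ht]

end Stable

end ExpStab

theorem mainTheorem2 (n : ℕ)
    (F : EuclideanSpace ℝ (Fin n) → EuclideanSpace ℝ (Fin n))
    (hF : ContDiff ℝ 1 F) (hF0 : F 0 = 0)
    (hcomplete : ∀ e : EuclideanSpace ℝ (Fin n), ∀ t : ℝ, 0 ≤ t → t ∈ ExpStab.flowDomain F e)
    (k k' : ℝ → ℝ) (lam lam' : ℝ) (hlam : 0 < lam) (hlam' : 0 < lam')
    (hE : ∀ e : EuclideanSpace ℝ (Fin n), ∀ t : ℝ, 0 ≤ t →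
      ‖ExpStab.flow F e t‖ ≤ k ‖e‖ * Real.exp (-lam * t) * ‖e‖)
    (hΦ : ∀ e : EuclideanSpace ℝ (Fin n), ∀ t : ℝ, 0 ≤ t →
      ‖ExpStab.transition F e t‖ ≤ k' ‖e‖ * Real.exp (-lam' * t))
    (Q : Matrix (Fin n) (Fin n) ℝ) (hQ : Q.PosDef) :
    -- `P` is well defined
    (∀ e : EuclideanSpace ℝ (Fin n),
      (∀ t : ℝ, 0 ≤ t → t ∈ ExpStab.solDomain (ExpStab.variationalField F e) 1) ∧
      MeasureTheory.IntegrableOn (ExpStab.lyapIntegrand F Q e) (Set.Ioi 0) ∧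
      Filter.Tendsto (fun T : ℝ => ∫ s in (0 : ℝ)..T, ExpStab.lyapIntegrand F Q e s)
        Filter.atTop (nhds (ExpStab.lyapMatrix F Q e))) ∧
    Continuous (ExpStab.lyapMatrix F Q) ∧
    (∃ p q : ℝ → ℝ, AntitoneOn p (Set.Ici 0) ∧ MonotoneOn q (Set.Ici 0) ∧
      ∀ e : EuclideanSpace ℝ (Fin n), 0 < p ‖e‖ ∧
        p ‖e‖ • (1 : Matrix (Fin n) (Fin n) ℝ) ≤ ExpStab.lyapMatrix F Q e ∧
        ExpStab.lyapMatrix F Q e ≤ q ‖e‖ • (1 : Matrix (Fin n) (Fin n) ℝ)) ∧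
    -- the derivative along the solutions exists and satisfies the matrix inequality
    (∀ e : EuclideanSpace ℝ (Fin n),
      HasDerivAt (fun h : ℝ => ExpStab.lyapMatrix F Q (ExpStab.flow F e h))
        (ExpStab.lieDeriv F (ExpStab.lyapMatrix F Q) e) 0 ∧
      ExpStab.lieDeriv F (ExpStab.lyapMatrix F Q) e
          + ExpStab.lyapMatrix F Q e * ExpStab.jacobian F e
          + (ExpStab.jacobian F e)ᵀ * ExpStab.lyapMatrix F Q e ≤ -Q) ∧
    (ContDiff ℝ 3 F → ContDiff ℝ 2 (ExpStab.lyapMatrix F Q)) := by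
  have h : ExpStab.Stable F :=
    { contDiff := hF
      mem_flowDomain := hcomplete
      eq_zero := hF0
      tendsto_flow := fun e => by
        have h1 : Filter.Tendsto (fun t : ℝ => k ‖e‖ * Real.exp (-lam * t) * ‖e‖) Filter.atTop
            (nhds 0) := by
          have := ((Real.tendsto_exp_atBot.comp (Filter.tendsto_id.const_mul_atTop_of_neg
            (neg_lt_zero.2 hlam))).const_mul (k ‖e‖)).mul_const ‖e‖
          simpa using this
        exact squeeze_zero_norm' ((Filter.eventually_ge_atTop 0).mono fun t ht => hE e t ht) h1
      norm_transition_le := fun e => ⟨k' ‖e‖, lam', hlam', hΦ e⟩ }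
  refine ⟨fun e => ⟨fun t ht => h.mem_solDomain_variationalField e ht,
    h.integrableOn_lyapIntegrand Q e, h.tendsto_lyapPartial Q e⟩,
    (h.contDiff_lyapMatrix Q (m := 0) (by simpa using hF)).continuous,
    h.exists_bounds_lyapMatrix hQ, fun e => ?_, fun hF3 => ?_⟩
  · have hd := h.hasDerivAt_lyapMatrix_flow_zero Q e
    have hlie : ExpStab.lieDeriv F (ExpStab.lyapMatrix F Q) e = _ := hd.deriv
    -- The Lyapunov inequality holds with equality.
    refine ⟨hlie ▸ hd, le_of_eq ?_⟩
    rw [hlie]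
    abel
  · exact h.contDiff_lyapMatrix Q (m := 2) (by norm_num; exact hF3)
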